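/- Let $n\ge 1$, and let $t=(t_0,\dots,t_n)$ be homogeneous coordinates on $\mathbb{CP}^n$. The general algebraic function $y$ of degree $n$, i.e. the multivalued analytic function whose branches are the analytic germs $y(t)$ with $$t_0y^n+t_1y^{n-1}+\cdots+t_{n-1}y+t_n=0,$$ is a Q-function of $(t_0,\dots,t_n)$ in the following sense. There exist $d\ge 0$ and a $d\times d$ matrix $\Omega$ of rational $1$-forms on $\mathbb{CP}^n$, with polar locus $\Sigma$ (the union of the polar loci of the entries), a nondegenerate multivalued matrix solution $X$ of $dX=\Omega X$ on $\mathbb{CP}^n\smallsetminus\Sigma$, and constants $c_{ij}\in\mathbb C$, such that over $\mathbb{CP}^n\smallsetminus\Sigma$ the branches of $y$ are exactly the germs obtained from one germ of $\sum_{i,j}c_{ij}X_{ij}$ by analytic continuation along paths in $\mathbb{CP}^n\smallsetminus\Sigma$, and such that $\Omega$ is a Q-system, that is: 1. (flatness) $d\Omega=\Omega\wedge\Omega$ on $\mathbb{CP}^n\smallsetminus\Sigma$; 2. (regularity) for every simply connected semialgebraic set $U\subseteq\mathbb{CP}^n\smallsetminus\Sigma$ and every branch over $U$ of a fundamental matrix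 solution $Z$ there are $C$ and $N<\infty$ with $|Z(p)|+|Z(p)^{-1}|\le C\,\mathrm{dist}(p,\Sigma)^{-N}$ for all $p\in U$; 3. (quasiunipotence) for every holomorphic germ $\gamma:(\mathbb C,0)\to(\mathbb{CP}^n,\Sigma)$ whose image is not contained in $\Sigma$, all eigenvalues of the monodromy matrix of the system along the image of each sufficiently small circle $\{|x|=\varepsilon\}$ under $\gamma$ are roots of unity; 4. (defined over $\mathbb Q$) $\Omega=\sum_{k=0}^n\Omega_k\,dt_k$ with all entries of the $\Omega_k$ in $\mathbb Q(t_0,\dots,t_n)$; equivalently, in the affine chart $t_0=1$ all coefficients of $\Omega$ lie in $\mathbb Q(t_1,\dots,t_n)$. -/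

import Mathlib

open Topology Filter

noncomputable section

namespace QFun

/-- The space `ℂ^{m+1}` of homogeneous coordinate vectors `(t_0, …, t_m)`. -/
abbrev Coords (m : ℕ) : Type := Fin (m + 1) → ℂ

/-- Complex projective space `ℂP^m`. -/
abbrev CP (m : ℕ) : Type := Projectivization ℂ (Coords m)

/-- `ℂP^m` carries the quotient topology of `ℂ^{m+1} ∖ {0}`. -/
instance instTopologicalSpaceCP (m : ℕ) : TopologicalSpace (CP m) :=
  TopologicalSpace.coinduced (Projectivization.mk' ℂ (V := Coords m)) inferInstance

/-- The cone over `U ⊆ ℂP^m`: all homogeneous coordinate vectors of points of `U`. -/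
def cone {m : ℕ} (U : Set (CP m)) : Set (Coords m) :=
  {z | ∃ hz : z ≠ 0, Projectivization.mk ℂ z hz ∈ U}

/-! ### Rational functions -/

/-- The field `ℂ(t_0, …, t_m)`. -/
abbrev RatFun (m : ℕ) : Type := FractionRing (MvPolynomial (Fin (m + 1)) ℂ)

namespace RatFun

variable {m : ℕ}

/-- `f` has a pole at `z`: the denominator of `f` in lowest terms vanishes at `z`. -/
def HasPoleAt (f : RatFun m) (z : Coords m) : Prop :=
  MvPolynomial.eval z
    (IsFractionRing.den (MvPolynomial (Fin (m + 1)) ℂ) f : MvPolynomial (Fin (m + 1)) ℂ) = 0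

/-- The value of `f` at `z`, computed from the representation in lowest terms
(only meaningful where `f` has no pole). -/
def value (f : RatFun m) (z : Coords m) : ℂ :=
  MvPolynomial.eval z (IsFractionRing.num (MvPolynomial (Fin (m + 1)) ℂ) f) /
    MvPolynomial.eval z
      (IsFractionRing.den (MvPolynomial (Fin (m + 1)) ℂ) f : MvPolynomial (Fin (m + 1)) ℂ)

/-- `f` is homogeneous of degree `-1`: a ratio of homogeneous polynomials of degrees `e`, `e+1`. -/
def IsHomogeneousNegOne (f : RatFun m) : Prop :=
  ∃ (e : ℕ) (p q : MvPolynomial (Fin (m + 1)) ℂ),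
    p.IsHomogeneous e ∧ q.IsHomogeneous (e + 1) ∧ q ≠ 0 ∧
      f = algebraMap _ (RatFun m) p / algebraMap _ (RatFun m) q

/-- `f` belongs to `ℚ(t_0, …, t_m)`: it is a ratio of polynomials with integer coefficients. -/
def IsDefinedOverRat (f : RatFun m) : Prop :=
  ∃ p q : MvPolynomial (Fin (m + 1)) ℤ, q ≠ 0 ∧
    f = algebraMap _ (RatFun m) (MvPolynomial.map (Int.castRingHom ℂ) p) /
      algebraMap _ (RatFun m) (MvPolynomial.map (Int.castRingHom ℂ) q)

end RatFun

/-! ### Pfaffian systems on `ℂP^m` -/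

/-- A rational `d × d`-matrix 1-form `Ω` on `ℂP^m`, written in homogeneous coordinates as
`Ω = ∑ k, Ω_k dt_k`. The form `∑ k, Ω_k dt_k` on `ℂ^{m+1}` is the pullback of a rational form on
`ℂP^m` exactly when the coefficients are homogeneous of degree `-1` and the contraction
`∑ k, t_k Ω_k` with the Euler field vanishes. -/
structure PfaffianForm (m d : ℕ) where
  coeff : Fin (m + 1) → Matrix (Fin d) (Fin d) (RatFun m)
  homogeneous : ∀ k i j, (coeff k i j).IsHomogeneousNegOne
  euler : ∀ i j,
    ∑ k, algebraMap _ (RatFun m) (MvPolynomial.X k : MvPolynomial (Fin (m + 1)) ℂ) *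
      coeff k i j = 0

/-- The partial derivative `∂f/∂t_k` at `z`. -/
def partialDeriv {m : ℕ} (k : Fin (m + 1)) (f : Coords m → ℂ) (z : Coords m) : ℂ :=
  fderiv ℂ f z (Pi.single k 1)

namespace PfaffianForm

variable {m d : ℕ} (Ω : PfaffianForm m d)

/-- The (cone over the) polar locus `Σ` of `Ω`: the union of the polar loci of its entries. -/
def polarLocus : Set (Coords m) :=
  {z | z ≠ 0 ∧ ∃ k i j, (Ω.coeff k i j).HasPoleAt z}

/-- The (cone over the) complement `ℂP^m ∖ Σ`. -/
def regularSet : Set (Coords m) :=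
  {z | z ≠ 0 ∧ z ∉ Ω.polarLocus}

/-- The value of the coefficient matrix `Ω_k` at `z`. -/
def coeffAt (k : Fin (m + 1)) (z : Coords m) : Matrix (Fin d) (Fin d) ℂ :=
  Matrix.of fun i j => (Ω.coeff k i j).value z

/-- `Ω` is defined over `ℚ` (in the given homogeneous coordinates). -/
def IsDefinedOverRat : Prop :=
  ∀ k i j, (Ω.coeff k i j).IsDefinedOverRat

/-- `Ω` is flat, `dΩ = Ω ∧ Ω` outside the polar locus; the coefficient of `dt_k ∧ dt_l` of this
identity is `∂_k Ω_l - ∂_l Ω_k = Ω_k Ω_l - Ω_l Ω_k`. -/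
def IsFlat : Prop :=
  ∀ z ∈ Ω.regularSet, ∀ k l i j,
    partialDeriv k (fun w => Ω.coeffAt l w i j) z - partialDeriv l (fun w => Ω.coeffAt k w i j) z =
      (Ω.coeffAt k z * Ω.coeffAt l z - Ω.coeffAt l z * Ω.coeffAt k z) i j

/-- `X` is (a representative of the germ at `z` of) a nondegenerate holomorphic matrix solution of
`dX = Ω X`, i.e. `∂_k X = Ω_k X` for all `k`. By the Euler relation such an `X` is automatically
locally constant along the lines through the origin, so it is a function on `ℂP^m`. -/
def IsFundamentalSolutionAt (z : Coords m) (X : Coords m → Matrix (Fin d) (Fin d) ℂ) : Prop :=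
  (∀ i j, AnalyticAt ℂ (fun w => X w i j) z) ∧ (X z).det ≠ 0 ∧
    ∀ᶠ w in 𝓝 z, ∀ k i j, partialDeriv k (fun v => X v i j) w = (Ω.coeffAt k w * X w) i j

end PfaffianForm

/-! ### Analytic continuation and monodromy -/

/-- `F` is an analytic continuation along the path `γ` of (the germ at `γ 0` of) the matrix function
`F 0`: a family of analytic germs, `F s` at `γ s`, such that for `s'` near `s` the germ `F s'` is
induced by `F s`. -/
def IsAnalyticContinuation {m d : ℕ} (γ : unitInterval → Coords m)
    (F : unitInterval → Coords m → Matrix (Fin d) (Fin d) ℂ) : Prop :=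
  (∀ s i j, AnalyticAt ℂ (fun w => F s w i j) (γ s)) ∧
    ∀ s, ∀ᶠ s' in 𝓝 s, F s' =ᶠ[𝓝 (γ s')] F s

/-- The parametrized circle `|x| = ε` in `ℂ`. -/
def circleLoop (ε : ℝ) (s : unitInterval) : ℂ :=
  (ε : ℂ) * Complex.exp (2 * Real.pi * Complex.I * ((s : ℝ) : ℂ))

namespace PfaffianForm

variable {m d : ℕ} (Ω : PfaffianForm m d)

/-- `Ω` is quasiunipotent: the monodromy along every small loop has only roots of unity as
eigenvalues. A small loop is the image of a small circle `|x| = ε` under a holomorphic germ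
`h : (ℂ, 0) → (ℂP^m, Σ)` whose image is not contained in `Σ` (such a germ lifts to a holomorphic
germ of homogeneous coordinate vectors). The monodromy matrix is the `M` for which the
continuation of a fundamental solution `X` along the loop is `X * M`. -/
def IsQuasiunipotent : Prop :=
  ∀ h : ℂ → Coords m, AnalyticAt ℂ h 0 → h 0 ∈ Ω.polarLocus →
    (∀ᶠ x in 𝓝[≠] (0 : ℂ), h x ∈ Ω.regularSet) →
    ∀ᶠ ε : ℝ in 𝓝[>] (0 : ℝ),
      ∀ (X : Coords m → Matrix (Fin d) (Fin d) ℂ)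
        (F : unitInterval → Coords m → Matrix (Fin d) (Fin d) ℂ) (M : Matrix (Fin d) (Fin d) ℂ),
        Ω.IsFundamentalSolutionAt (h ε) X →
        IsAnalyticContinuation (fun s => h (circleLoop ε s)) F →
        F 0 =ᶠ[𝓝 (h ε)] X →
        F 1 =ᶠ[𝓝 (h ε)] (fun w => X w * M) →
        ∀ μ ∈ spectrum ℂ M, ∃ k : ℕ, 0 < k ∧ μ ^ k = 1

end PfaffianForm

/-! ### Regularity -/

/-- Semialgebraic subsets of `ℝ^ι`: the Boolean algebra generated by the sets `{p > 0}`, where `p`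
is a real polynomial. -/
inductive IsSemialgebraicReal {ι : Type} : Set (ι → ℝ) → Prop
  | pos (p : MvPolynomial ι ℝ) : IsSemialgebraicReal {x | 0 < MvPolynomial.eval x p}
  | compl {s : Set (ι → ℝ)} : IsSemialgebraicReal s → IsSemialgebraicReal sᶜ
  | union {s t : Set (ι → ℝ)} :
      IsSemialgebraicReal s → IsSemialgebraicReal t → IsSemialgebraicReal (s ∪ t)

/-- `U ⊆ ℂP^m` is semialgebraic: the cone over `U` is a semialgebraic subset of
`ℂ^{m+1} = ℝ^{2m+2}` (real and imaginary parts as coordinates). -/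
def IsSemialgebraic {m : ℕ} (U : Set (CP m)) : Prop :=
  IsSemialgebraicReal {x : Fin (m + 1) ⊕ Fin (m + 1) → ℝ |
    (fun k => (x (Sum.inl k) : ℂ) + (x (Sum.inr k) : ℂ) * Complex.I) ∈ cone U}

/-- The distance in `ℂP^m` from the point with homogeneous coordinates `z` to the set with cone `S`.
It is the sine of the Fubini--Study distance (the chordal distance), computed with the Hermitian
norm of `ℂ^{m+1}`. -/
def projDist {m : ℕ} (z : Coords m) (S : Set (Coords m)) : ℝ :=
  Metric.infDist (WithLp.toLp 2 z : EuclideanSpace ℂ (Fin (m + 1)))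
      ((fun w => (WithLp.toLp 2 w : EuclideanSpace ℂ (Fin (m + 1)))) '' S) /
    ‖(WithLp.toLp 2 z : EuclideanSpace ℂ (Fin (m + 1)))‖

namespace PfaffianForm

variable {m d : ℕ} (Ω : PfaffianForm m d)

/-- `F` is a branch over `U` of a fundamental matrix solution: it assigns to each point of (the cone
over) `U` the germ `F z` of a fundamental solution at `z`, compatibly for nearby points. -/
def IsSolutionBranchOn (U : Set (CP m))
    (F : Coords m → Coords m → Matrix (Fin d) (Fin d) ℂ) : Prop :=
  (∀ z ∈ cone U, Ω.IsFundamentalSolutionAt z (F z)) ∧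
    ∀ z ∈ cone U, ∀ᶠ w in 𝓝[cone U] z, F w =ᶠ[𝓝 w] F z

/-- `Ω` is regular: inside any simply connected semialgebraic `U ⊆ ℂP^m ∖ Σ`, every fundamental
solution satisfies `|X(z)| + |X(z)⁻¹| ≤ C dist(z, Σ)^{-N}` for some finite `C`, `N`. -/
def IsRegular : Prop :=
  ∀ U : Set (CP m), IsSemialgebraic U → SimplyConnectedSpace U → cone U ⊆ Ω.regularSet →
    ∀ F, Ω.IsSolutionBranchOn U F →
      ∃ (C : ℝ) (N : ℕ), ∀ z ∈ cone U, ∀ i j,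
        ‖F z z i j‖ + ‖(F z z)⁻¹ i j‖ ≤ C * ((projDist z Ω.polarLocus)⁻¹) ^ N

/-- A Q-system is a flat regular quasiunipotent Pfaffian system defined over `ℚ`. -/
structure IsQSystem : Prop where
  flat : Ω.IsFlat
  regular : Ω.IsRegular
  quasiunipotent : Ω.IsQuasiunipotent
  definedOverRat : Ω.IsDefinedOverRat

end PfaffianForm

/-! ### Q-functions -/

/-- A multivalued analytic function of the homogeneous coordinates of `ℂP^m`, given by its branches:
`B z f` says that `f` is (a representative of) a germ at `z` of a branch. -/
abbrev Multivalued (m : ℕ) : Type := Coords m → (Coords m → ℂ) → Prop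

/-- `B` is a Q-function: there are a Q-system `Ω` with polar locus `Σ`, a fundamental matrix solution
`X` (given by its germ at a point `a` outside `Σ`), and constants `c_ij`, such that over `ℂP^m ∖ Σ`
the branches of `B` are precisely the branches of `∑ c_ij X_ij`, that is, the germs obtained from
this linear combination by analytic continuation of `X` along the paths outside `Σ` that start
at `a`. -/
def IsQFunction {m : ℕ} (B : Multivalued m) : Prop :=
  ∃ (d : ℕ) (Ω : PfaffianForm m d), Ω.IsQSystem ∧
    ∃ a ∈ Ω.regularSet, ∃ X : Coords m → Matrix (Fin d) (Fin d) ℂ,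
      Ω.IsFundamentalSolutionAt a X ∧
      ∃ c : Matrix (Fin d) (Fin d) ℂ,
        ∀ z ∈ Ω.regularSet, ∀ f : Coords m → ℂ,
          B z f ↔
            ∃ (γ : Path a z) (F : unitInterval → Coords m → Matrix (Fin d) (Fin d) ℂ),
              (∀ s, γ s ∈ Ω.regularSet) ∧ IsAnalyticContinuation γ F ∧ F 0 =ᶠ[𝓝 a] X ∧
                f =ᶠ[𝓝 z] fun w => ∑ i, ∑ j, c i j * F 1 w i j

/-- The general algebraic function `y` of degree `n`: its branches are the analytic germs `y` with
`t_0 y^n + t_1 y^{n-1} + ⋯ + t_{n-1} y + t_n = 0`. -/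
def generalAlgebraicFunction (n : ℕ) : Multivalued n := fun z y =>
  AnalyticAt ℂ y z ∧
    ∀ᶠ t in 𝓝 z, ∑ i : Fin (n + 1), t i * y t ^ (n - (i : ℕ)) = 0

end QFun

end

open Topology Filter

noncomputable section

/-! Where the roots of P(y) = t_0 y^n + ⋯ + t_n are distinct and nonzero, implicit differentiation
gives d(y^i) = -i y^i ∑_k y^{n-k} dt_k / (y P'(y)). The companion matrix C has the vector of powers
of each root y as an eigenvector with eigenvalue y, so the scalar y^{n-k} / (y P'(y)) may be
replaced by the matrix C^{n-k} (C P'(C))⁻¹, which is the same for all roots. Hence the vectors (y_j,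
…, y_j^n) all solve one linear system over ℚ(t), and they are independent: their determinant is ∏
y_j times a Vandermonde determinant. Starting the powers at y instead of 1 makes y an entry even for
n = 1. The contraction ∑ t_k Ω_k is a multiple of P(C) = 0, so the form descends to projective
space. Scaling C by t_0 turns C P'(C) into the polynomial matrix E = `eulerMatrix` and avoids
denominators.

Poles of this system might cancel, which would make Σ hard to identify. A second block is therefore
added, with a constant and the degree-0 functions t_k^N t_j / G, where G = `poleFun` = t_0 det E and
N = n(n+1). The poles of their differentials force Σ to be exactly G = 0 (`mem_regularSet_iff`).

The remaining claims rest on one fact: every fundamental matrix is locally `fundMatrix` of an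
analytic numbering of the roots times a constant matrix (`IsFundamentalSolutionAt.exists_eq_mul`),
and this description survives continuation because it is a family of analytic equations
(`isSolGerm_of_isAnalyticContinuation`). Flatness follows from the existence of invertible
solutions. A loop permutes the roots, so monodromy is conjugate to a permutation matrix and has
finite order. For regularity, `fundMatrix` and its inverse are bounded by powers of 1 + 1/|G| on
normalized vectors, and |G| is bounded below by a power of the distance to its zero set
(`infDist_pow_le`). Finally, any two numberings of the roots are joined by a path
(`exists_path_isRootSystem`), so continuation reaches every branch of y. -/

namespace QFun

/-! ### The companion matrix and the connection on the powers of a root -/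

section Companion

variable {S T : Type*} [CommRing S] [CommRing T] {n : ℕ}

/-- The general polynomial `t_0 y^n + ⋯ + t_n`. -/
def generalPoly (t : Fin (n + 1) → S) (y : S) : S :=
  ∑ i : Fin (n + 1), t i * y ^ (n - (i : ℕ))

/-- `y` times the derivative of the general polynomial. -/
def eulerPoly (t : Fin (n + 1) → S) (y : S) : S :=
  ∑ i : Fin (n + 1), ((n - (i : ℕ) : ℕ) : S) * t i * y ^ (n - (i : ℕ))

/-- The companion matrix of the general polynomial, multiplied by `t_0`. -/
def scaledCompanion (t : Fin (n + 1) → S) : Matrix (Fin n) (Fin n) S :=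
  Matrix.of fun i j =>
    if (i : ℕ) + 1 = n then -t (Fin.rev j.castSucc) else if (j : ℕ) = i + 1 then t 0 else 0

/-- The value of `y P'(y)` on the companion matrix, multiplied by `t_0 ^ n`. -/
def eulerMatrix (t : Fin (n + 1) → S) : Matrix (Fin n) (Fin n) S :=
  ∑ i : Fin (n + 1),
    (((n - (i : ℕ) : ℕ) : S) * t i * t 0 ^ (i : ℕ)) • scaledCompanion t ^ (n - (i : ℕ))

/-- A polynomial whose zero locus contains `t_0 = 0`, `t_n = 0` and the discriminant. -/
def poleFun (t : Fin (n + 1) → S) : S := t 0 * (eulerMatrix t).det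

/-- The numerator of the connection matrix of the powers `y, …, y ^ n`. -/
def powerNum (t : Fin (n + 1) → S) (k : Fin (n + 1)) : Matrix (Fin n) (Fin n) S :=
  Matrix.diagonal (fun i : Fin n => -((i : ℕ) + 1 : S)) *
    (t 0 ^ (k : ℕ) • (scaledCompanion t ^ (n - (k : ℕ)) * (eulerMatrix t).adjugate))

theorem map_generalPoly (f : S →+* T) (t : Fin (n + 1) → S) (y : S) :
    f (generalPoly t y) = generalPoly (f ∘ t) (f y) := by
  simp [generalPoly]

theorem map_eulerPoly (f : S →+* T) (t : Fin (n + 1) → S) (y : S) :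
    f (eulerPoly t y) = eulerPoly (f ∘ t) (f y) := by
  simp [eulerPoly]

theorem map_scaledCompanion (f : S →+* T) (t : Fin (n + 1) → S) :
    f.mapMatrix (scaledCompanion t) = scaledCompanion (f ∘ t) := by
  ext i j
  simp only [scaledCompanion, RingHom.mapMatrix_apply, Matrix.map_apply, Matrix.of_apply]
  split_ifs <;> simp

theorem mapMatrix_smul' {ι : Type*} [Fintype ι] [DecidableEq ι] (f : S →+* T) (c : S)
    (M : Matrix ι ι S) : f.mapMatrix (c • M) = f c • f.mapMatrix M := by
  ext i j
  simp

theorem map_eulerMatrix (f : S →+* T) (t : Fin (n + 1) → S) :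
    f.mapMatrix (eulerMatrix t) = eulerMatrix (f ∘ t) := by
  simp [eulerMatrix, -RingHom.mapMatrix_apply, mapMatrix_smul', map_scaledCompanion]

theorem map_poleFun (f : S →+* T) (t : Fin (n + 1) → S) :
    f (poleFun t) = poleFun (f ∘ t) := by
  simp [poleFun, RingHom.map_det, map_eulerMatrix, -RingHom.mapMatrix_apply]

theorem map_powerNum (f : S →+* T) (t : Fin (n + 1) → S) (k : Fin (n + 1)) :
    f.mapMatrix (powerNum t k) = powerNum (f ∘ t) k := by
  have : f.mapMatrix (Matrix.diagonal (fun i : Fin n => -((i : ℕ) + 1 : S))) =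
      Matrix.diagonal (fun i : Fin n => -((i : ℕ) + 1 : T)) := by
    simp [Matrix.diagonal_map]
  rw [powerNum, map_mul, this, mapMatrix_smul', map_mul, map_pow, map_pow, map_scaledCompanion,
    RingHom.map_adjugate, map_eulerMatrix]
  rfl

/-- The last row encodes P(y) = 0 and the other rows are shifts. Keeping the factor t_0 makes this
valid over any commutative ring, which is needed later for a ring of functions that is not a field.
-/
theorem scaledCompanion_mulVec {t : Fin (n + 1) → S} {y : S} (h : generalPoly t y = 0) :
    (scaledCompanion t).mulVec (fun i : Fin n => y ^ (i : ℕ)) =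
      (t 0 * y) • fun i : Fin n => y ^ (i : ℕ) := by
  have h' : ∑ j : Fin n, t (Fin.rev j.castSucc) * y ^ (j : ℕ) + t 0 * y ^ n = 0 := by
    rw [← h, generalPoly]
    conv_rhs => rw [← Equiv.sum_comp Fin.revPerm, Fin.sum_univ_castSucc]
    simp only [Fin.revPerm_apply, Fin.val_rev, Fin.val_castSucc, Fin.rev_last]
    congr 1
    · refine Finset.sum_congr rfl fun j _ => ?_
      congr 2
      omega
  funext i
  simp only [Matrix.mulVec, dotProduct, scaledCompanion, Matrix.of_apply, Pi.smul_apply,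
    smul_eq_mul]
  by_cases hi : (i : ℕ) + 1 = n
  · simp only [hi, if_true]
    calc ∑ j : Fin n, -t (Fin.rev j.castSucc) * y ^ (j : ℕ)
        = -∑ j : Fin n, t (Fin.rev j.castSucc) * y ^ (j : ℕ) := by
          rw [← Finset.sum_neg_distrib]
          exact Finset.sum_congr rfl fun j _ => by ring
      _ = t 0 * y * y ^ (i : ℕ) := by
          rw [mul_assoc, ← pow_succ', hi]
          linear_combination -h'
  · simp only [hi, if_false]
    have hlt : (i : ℕ) + 1 < n := by omega
    rw [Finset.sum_eq_single (⟨i + 1, hlt⟩ : Fin n)]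
    · simp
      ring
    · intro j _ hj
      have : (j : ℕ) ≠ i + 1 := fun h => hj (Fin.ext h)
      simp [this]
    · simp

theorem scaledCompanion_pow_mulVec {t : Fin (n + 1) → S} {y : S} (h : generalPoly t y = 0)
    (k : ℕ) :
    (scaledCompanion t ^ k).mulVec (fun i : Fin n => y ^ (i : ℕ)) =
      (t 0 * y) ^ k • fun i : Fin n => y ^ (i : ℕ) := by
  induction k with
  | zero => simp
  | succ k ih =>
    rw [pow_succ, ← Matrix.mulVec_mulVec, scaledCompanion_mulVec h, Matrix.mulVec_smul, ih,
      smul_smul, pow_succ, mul_comm]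

theorem eulerMatrix_mulVec {t : Fin (n + 1) → S} {y : S} (h : generalPoly t y = 0) :
    (eulerMatrix t).mulVec (fun i : Fin n => y ^ (i : ℕ)) =
      (t 0 ^ n * eulerPoly t y) • fun i : Fin n => y ^ (i : ℕ) := by
  rw [eulerMatrix, Matrix.sum_mulVec, eulerPoly, Finset.mul_sum, Finset.sum_smul]
  refine Finset.sum_congr rfl fun i _ => ?_
  rw [Matrix.smul_mulVec, scaledCompanion_pow_mulVec h, smul_smul]
  congr 1
  have : t 0 ^ n = t 0 ^ (i : ℕ) * t 0 ^ (n - (i : ℕ)) := by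
    rw [← pow_add]
    congr 1
    omega
  rw [this, mul_pow]
  ring

/-- Apply the adjugate to the eigenvector equation of E. As the first coordinate of the eigenvector
is 1, this exhibits det E as a multiple of y P'(y). -/
theorem adjugate_eulerMatrix_mulVec {t : Fin (n + 1) → S} {y : S} (h : generalPoly t y = 0) :
    (t 0 ^ n * eulerPoly t y) •
      (eulerMatrix t).adjugate.mulVec (fun i : Fin n => y ^ (i : ℕ)) =
      (eulerMatrix t).det • fun i : Fin n => y ^ (i : ℕ) := by
  rw [← Matrix.mulVec_smul, ← eulerMatrix_mulVec h, Matrix.mulVec_mulVec, Matrix.adjugate_mul,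
    Matrix.smul_mulVec, Matrix.one_mulVec]

/-- The division-free form of the differential equation: on the eigenvector, t_0^k (t_0 C)^{n-k}
acts as t_0^n y^{n-k} and E as t_0^n y P'(y). The common factor t_0^n cannot be cancelled in a
general ring. -/
theorem eulerPoly_mul_powerNum_mulVec {t : Fin (n + 1) → S} {y : S} (h : generalPoly t y = 0)
    (k : Fin (n + 1)) (i : Fin n) :
    t 0 ^ n * (eulerPoly t y * (powerNum t k).mulVec (fun i : Fin n => y ^ ((i : ℕ) + 1)) i) =
      t 0 ^ n * (-((i : ℕ) + 1 : S) * y ^ (n - (k : ℕ)) * y ^ ((i : ℕ) + 1) *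
        (eulerMatrix t).det) := by
  have hk : t 0 ^ (k : ℕ) * t 0 ^ (n - (k : ℕ)) = t 0 ^ n := by
    rw [← pow_add]
    congr 1
    omega
  have key : (t 0 ^ n * eulerPoly t y) •
      (scaledCompanion t ^ (n - (k : ℕ)) * (eulerMatrix t).adjugate).mulVec
        (fun i : Fin n => y ^ ((i : ℕ) + 1)) =
      ((eulerMatrix t).det * (t 0 * y) ^ (n - (k : ℕ))) • fun i : Fin n => y ^ ((i : ℕ) + 1) := by
    have hv : (fun i : Fin n => y ^ ((i : ℕ) + 1)) = y • fun i : Fin n => y ^ (i : ℕ) := by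
      funext i
      simp [pow_succ']
    rw [hv, ← Matrix.mulVec_mulVec, Matrix.mulVec_smul, Matrix.mulVec_smul, smul_comm _ y,
      ← Matrix.mulVec_smul, adjugate_eulerMatrix_mulVec h,
      Matrix.mulVec_smul, scaledCompanion_pow_mulVec h]
    simp only [smul_smul]
    congr 1
    ring
  have key' := congrFun key i
  simp only [Pi.smul_apply, smul_eq_mul] at key'
  rw [powerNum, ← Matrix.mulVec_mulVec, Matrix.mulVec_diagonal, Matrix.smul_mulVec, Pi.smul_apply,
    smul_eq_mul]
  rw [mul_pow] at key'
  linear_combination (-((i : ℕ) + 1 : S) * t 0 ^ (k : ℕ)) * key' +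
    (-((i : ℕ) + 1 : S) * (eulerMatrix t).det * y ^ (n - (k : ℕ)) * y ^ ((i : ℕ) + 1)) * hk

end Companion

/-! ### Cayley–Hamilton for the companion matrix and the Euler relation -/

section CayleyHamilton

variable {S : Type*} [CommRing S] {n : ℕ}

theorem single_vecMul_scaledCompanion (t : Fin (n + 1) → S) (i : Fin n) (hi : (i : ℕ) + 1 < n) :
    Matrix.vecMul (Pi.single i 1 : Fin n → S) (scaledCompanion t) =
      t 0 • (Pi.single ⟨i + 1, hi⟩ 1 : Fin n → S) := by
  funext j
  simp only [Matrix.single_one_vecMul, scaledCompanion, Pi.smul_apply, smul_eq_mul]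
  have : (i : ℕ) + 1 ≠ n := by omega
  by_cases hj : (j : ℕ) = i + 1
  · have : j = ⟨i + 1, hi⟩ := Fin.ext hj
    subst this
    simp [*]
  · have : j ≠ ⟨i + 1, hi⟩ := fun h => hj (by rw [h])
    simp [*]

/-- The first basis row vector is cyclic up to powers of t_0, so a matrix commuting with the
companion matrix is determined by its first row once t_0 can be cancelled. -/
theorem single_zero_vecMul_scaledCompanion_pow (t : Fin (n + 1) → S) (hn : 0 < n) (k : ℕ)
    (hk : k < n) :
    Matrix.vecMul (Pi.single ⟨0, hn⟩ 1 : Fin n → S) (scaledCompanion t ^ k) =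
      t 0 ^ k • (Pi.single ⟨k, hk⟩ 1 : Fin n → S) := by
  induction k with
  | zero => simp
  | succ k ih =>
    have hk' : k < n := by omega
    rw [pow_succ, ← Matrix.vecMul_vecMul, ih hk', Matrix.smul_vecMul,
      single_vecMul_scaledCompanion t ⟨k, hk'⟩ hk, smul_smul, pow_succ]

/-- The companion matrix is a root of the general polynomial. -/
theorem sum_smul_scaledCompanion_pow [IsDomain S] (t : Fin (n + 1) → S) (h0 : t 0 ≠ 0) :
    ∑ k : Fin (n + 1), (t k * t 0 ^ (k : ℕ)) • scaledCompanion t ^ (n - (k : ℕ)) = 0 := by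
  rcases Nat.eq_zero_or_pos n with rfl | hn
  · exact Subsingleton.elim _ _
  set M := ∑ k : Fin (n + 1), (t k * t 0 ^ (k : ℕ)) • scaledCompanion t ^ (n - (k : ℕ)) with hM
  obtain ⟨m, rfl⟩ : ∃ m, n = m + 1 := ⟨n - 1, by omega⟩
  -- In the first row, the term with the n-th power produces the last row of the companion matrix,
  -- that is, minus the coefficients of P; these cancel the other terms one by one.
  have h1 : Matrix.vecMul (Pi.single ⟨0, hn⟩ 1 : Fin (m + 1) → S) M = 0 := by
    have htop : Matrix.vecMul (Pi.single ⟨0, hn⟩ 1 : Fin (m + 1) → S)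
        (scaledCompanion t ^ (m + 1)) = -(t 0 ^ m • fun j : Fin (m + 1) => t j.castSucc.rev) := by
      rw [pow_succ, ← Matrix.vecMul_vecMul,
        single_zero_vecMul_scaledCompanion_pow t hn m (Nat.lt_succ_self m), Matrix.smul_vecMul]
      funext j
      simp [scaledCompanion]
    rw [hM, Matrix.vecMul_sum, Fin.sum_univ_succ]
    simp only [Fin.val_zero, pow_zero, mul_one, Nat.sub_zero, Matrix.vecMul_smul, htop,
      Fin.val_succ]
    funext j
    simp only [Pi.add_apply, Finset.sum_apply, Pi.smul_apply, Pi.neg_apply, smul_eq_mul,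
      Pi.zero_apply]
    rw [Finset.sum_eq_single (Fin.rev j)]
    · have hlt : m + 1 - ((Fin.rev j : ℕ) + 1) < m + 1 := by omega
      rw [single_zero_vecMul_scaledCompanion_pow t hn _ hlt]
      have hj : (⟨m + 1 - ((Fin.rev j : ℕ) + 1), hlt⟩ : Fin (m + 1)) = j :=
        Fin.ext (by simp only [Fin.val_rev]; omega)
      rw [hj]
      simp only [Pi.smul_apply, Pi.single_eq_same, smul_eq_mul, mul_one]
      rw [← Fin.rev_castSucc, mul_assoc, ← pow_add]
      have : (Fin.rev j : ℕ) + 1 + (m + 1 - ((Fin.rev j : ℕ) + 1)) = m + 1 := by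
        simp only [Fin.val_rev]; omega
      rw [this, pow_succ]
      ring
    · intro k _ hk
      have hlt : m + 1 - ((k : ℕ) + 1) < m + 1 := by omega
      rw [single_zero_vecMul_scaledCompanion_pow t hn _ hlt]
      have : j ≠ (⟨m + 1 - ((k : ℕ) + 1), hlt⟩ : Fin (m + 1)) := by
        rintro rfl
        apply hk
        ext
        simp only [Fin.val_rev]
        omega
      simp only [Pi.smul_apply, Pi.single_eq_of_ne this, smul_zero, mul_zero]
    · simp
  -- Commuting M with powers of the companion matrix moves the vanishing of the first row to every
  -- row, up to a power of t_0.
  have hcomm : ∀ k : ℕ, Commute (scaledCompanion t ^ k) M := fun k =>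
    Commute.sum_right _ _ _ fun i _ => ((Commute.refl _).pow_pow _ _).smul_right _
  ext i j
  have h2 : Matrix.vecMul (t 0 ^ (i : ℕ) • (Pi.single i 1 : Fin (m + 1) → S)) M = 0 := by
    rw [← single_zero_vecMul_scaledCompanion_pow t hn i i.2, Matrix.vecMul_vecMul, (hcomm i).eq,
      ← Matrix.vecMul_vecMul, h1, Matrix.zero_vecMul]
  have h3 := congrFun h2 j
  simpa [Matrix.smul_vecMul, h0] using h3

/-- After factoring out the diagonal matrix and the adjugate, what is left is P evaluated at the
companion matrix. -/
theorem sum_smul_powerNum [IsDomain S] (t : Fin (n + 1) → S) (h0 : t 0 ≠ 0) :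
    ∑ k : Fin (n + 1), t k • powerNum t k = 0 := by
  have h : ∀ k : Fin (n + 1), t k • powerNum t k =
      Matrix.diagonal (fun i : Fin n => -((i : ℕ) + 1 : S)) *
        (((t k * t 0 ^ (k : ℕ)) • scaledCompanion t ^ (n - (k : ℕ))) * (eulerMatrix t).adjugate) := by
    intro k
    rw [powerNum, ← Matrix.mul_smul, smul_smul, Matrix.smul_mul]
  simp_rw [h]
  rw [← Matrix.mul_sum, ← Matrix.sum_mul, sum_smul_scaledCompanion_pow t h0]
  simp

end CayleyHamilton

/-! ### Homogeneity degrees -/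

section Homogeneous

open MvPolynomial

variable {σ R : Type*} [CommRing R] {n : ℕ}

/-- All entries are homogeneous of the same degree. -/
def MatrixIsHomogeneous {ι : Type*} (A : Matrix ι ι (MvPolynomial σ R)) (k : ℕ) : Prop :=
  ∀ i j, (A i j).IsHomogeneous k

theorem isHomogeneous_natCast (c : ℕ) : ((c : MvPolynomial σ R)).IsHomogeneous 0 := by
  rw [← map_natCast (C : R →+* MvPolynomial σ R)]
  exact isHomogeneous_C _ _

namespace MatrixIsHomogeneous

variable {ι : Type*} {A B : Matrix ι ι (MvPolynomial σ R)} {k l : ℕ}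

theorem smul {c : MvPolynomial σ R} (hc : c.IsHomogeneous k) (hA : MatrixIsHomogeneous A l) :
    MatrixIsHomogeneous (c • A) (k + l) := fun i j => hc.mul (hA i j)

theorem mul [Fintype ι] (hA : MatrixIsHomogeneous A k) (hB : MatrixIsHomogeneous B l) :
    MatrixIsHomogeneous (A * B) (k + l) := fun i j =>
  IsHomogeneous.sum _ _ _ fun x _ => (hA i x).mul (hB x j)

variable [DecidableEq ι]

theorem diagonal {c : ι → MvPolynomial σ R} (hc : ∀ i, (c i).IsHomogeneous k) :
    MatrixIsHomogeneous (Matrix.diagonal c) k := by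
  intro i j
  rcases eq_or_ne i j with rfl | h
  · simpa using hc i
  · rw [Matrix.diagonal_apply_ne _ h]
    exact isHomogeneous_zero _ _ _

variable [Fintype ι]

theorem pow (hA : MatrixIsHomogeneous A k) (m : ℕ) : MatrixIsHomogeneous (A ^ m) (k * m) := by
  induction m with
  | zero =>
    rw [pow_zero, mul_zero, ← Matrix.diagonal_one]
    exact diagonal fun _ => isHomogeneous_one _ _
  | succ m ih => rw [pow_succ, Nat.mul_succ]; exact ih.mul hA

/-- Degrees may vary from row to row because an entry of the adjugate is a determinant in which one
row is replaced by a basis vector, of degree 0. -/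
theorem det_of_rows {r : ι → ℕ} (hA : ∀ i j, (A i j).IsHomogeneous (r i)) :
    A.det.IsHomogeneous (∑ i, r i) := by
  rw [Matrix.det_apply]
  refine IsHomogeneous.sum _ _ _ fun s _ => ?_
  have h : (∏ i, A (s i) i).IsHomogeneous (∑ i, r i) := by
    rw [← Equiv.sum_comp s r]
    exact IsHomogeneous.prod _ _ _ fun i _ => hA _ _
  rcases Int.units_eq_one_or (Equiv.Perm.sign s) with h1 | h1
  · simpa [h1] using h
  · simpa [h1] using h.neg

theorem det (hA : MatrixIsHomogeneous A k) : A.det.IsHomogeneous (Fintype.card ι * k) := by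
  simpa using det_of_rows (r := fun _ => k) hA

theorem adjugate (hA : MatrixIsHomogeneous A k) :
    MatrixIsHomogeneous A.adjugate ((Fintype.card ι - 1) * k) := by
  intro i j
  rw [Matrix.adjugate_apply]
  have h := det_of_rows (A := A.updateRow j (Pi.single i 1))
    (r := fun x => if x = j then 0 else k) ?_
  · convert h using 1
    rw [Finset.sum_ite, Finset.sum_const_zero, Finset.sum_const, Finset.filter_ne',
      Finset.card_erase_of_mem (Finset.mem_univ j), zero_add, smul_eq_mul, Finset.card_univ]
  · intro x y
    rcases eq_or_ne x j with rfl | hx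
    · rcases eq_or_ne y i with rfl | hy
      · simpa using isHomogeneous_one _ _
      · simpa [Pi.single_eq_of_ne hy] using isHomogeneous_zero _ _ _
    · simpa [hx] using hA x y

end MatrixIsHomogeneous

variable (R) in
theorem scaledCompanion_isHomogeneous :
    MatrixIsHomogeneous (scaledCompanion (X : Fin (n + 1) → MvPolynomial (Fin (n + 1)) R)) 1 := by
  intro i j
  simp only [scaledCompanion, Matrix.of_apply]
  split_ifs
  · exact (isHomogeneous_X _ _).neg
  · exact isHomogeneous_X _ _
  · exact isHomogeneous_zero _ _ _

variable (R) in
theorem eulerMatrix_isHomogeneous :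
    MatrixIsHomogeneous (eulerMatrix (X : Fin (n + 1) → MvPolynomial (Fin (n + 1)) R))
      (n + 1) := by
  intro i j
  rw [eulerMatrix, Matrix.sum_apply]
  refine IsHomogeneous.sum _ _ _ fun k _ => ?_
  have h := MatrixIsHomogeneous.smul
    (((isHomogeneous_natCast (n - (k : ℕ))).mul (isHomogeneous_X R k)).mul
      (isHomogeneous_X_pow (R := R) (0 : Fin (n + 1)) (k : ℕ)))
    ((scaledCompanion_isHomogeneous (n := n) R).pow (n - (k : ℕ)))
  convert h i j using 1
  omega

variable (R) in
theorem poleFun_isHomogeneous :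
    (poleFun (X : Fin (n + 1) → MvPolynomial (Fin (n + 1)) R)).IsHomogeneous
      (n * (n + 1) + 1) := by
  have h := (isHomogeneous_X R (0 : Fin (n + 1))).mul (eulerMatrix_isHomogeneous (n := n) R).det
  rw [Fintype.card_fin] at h
  rw [Nat.add_comm (n * (n + 1)) 1]
  exact h

variable (R) in
theorem powerNum_isHomogeneous (k : Fin (n + 1)) :
    MatrixIsHomogeneous (powerNum (X : Fin (n + 1) → MvPolynomial (Fin (n + 1)) R) k)
      (n + (n - 1) * (n + 1)) := by
  have h1 : MatrixIsHomogeneous (Matrix.diagonal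
      (fun i : Fin n => -((i : ℕ) + 1 : MvPolynomial (Fin (n + 1)) R))) 0 := by
    refine MatrixIsHomogeneous.diagonal fun i => ?_
    have := isHomogeneous_natCast (σ := Fin (n + 1)) (R := R) ((i : ℕ) + 1)
    push_cast at this
    exact this.neg
  have h := h1.mul (MatrixIsHomogeneous.smul
    (isHomogeneous_X_pow (R := R) (0 : Fin (n + 1)) (k : ℕ))
    (((scaledCompanion_isHomogeneous (n := n) R).pow (n - (k : ℕ))).mul
      (eulerMatrix_isHomogeneous (n := n) R).adjugate))
  rw [Fintype.card_fin] at h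
  convert h using 1
  · rw [powerNum]
  · have := k.2
    generalize (n - 1) * (n + 1) = x
    omega

end Homogeneous

section MvPolynomial

open MvPolynomial

/-! ### Poles and values of rational functions -/

section RatFun

variable {m : ℕ}

/-- The reduced denominator divides any other denominator of the same fraction, so it cannot vanish
where q does not. -/
theorem RatFun.value_div {p q : MvPolynomial (Fin (m + 1)) ℂ} {z : Coords m}
    (hq : eval z q ≠ 0) :
    ¬ RatFun.HasPoleAt (algebraMap _ (RatFun m) p / algebraMap _ (RatFun m) q) z ∧
      RatFun.value (algebraMap _ (RatFun m) p / algebraMap _ (RatFun m) q) z =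
        eval z p / eval z q := by
  set f : RatFun m := algebraMap _ (RatFun m) p / algebraMap _ (RatFun m) q with hf
  set a := IsFractionRing.num (MvPolynomial (Fin (m + 1)) ℂ) f with ha
  set b : MvPolynomial (Fin (m + 1)) ℂ :=
    (IsFractionRing.den (MvPolynomial (Fin (m + 1)) ℂ) f : MvPolynomial (Fin (m + 1)) ℂ) with hb
  have hq0 : q ≠ 0 := by rintro rfl; simp at hq
  have hb0 : b ≠ 0 := nonZeroDivisors.ne_zero (IsFractionRing.den _ f).2
  have hinj : Function.Injective (algebraMap (MvPolynomial (Fin (m + 1)) ℂ) (RatFun m)) :=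
    IsFractionRing.injective _ _
  have hab : a * q = p * b := by
    have h := IsFractionRing.mk'_num_den' (MvPolynomial (Fin (m + 1)) ℂ) f
    rw [← ha, ← hb, hf, div_eq_div_iff (by simpa using hb0) (by simpa using hq0)] at h
    exact hinj (by simpa only [map_mul] using h)
  have hdvd : b ∣ q :=
    (IsFractionRing.num_den_reduced (MvPolynomial (Fin (m + 1)) ℂ) f).symm.dvd_of_dvd_mul_left
      (Dvd.intro_left p hab.symm)
  obtain ⟨c, hc⟩ := hdvd
  have hbz : eval z b ≠ 0 := by
    intro h
    rw [hc, map_mul, h, zero_mul] at hq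
    exact hq rfl
  refine ⟨hbz, ?_⟩
  have := congrArg (eval z) hab
  simp only [map_mul] at this
  rw [RatFun.value, div_eq_div_iff hbz hq]
  exact this

theorem RatFun.exists_mul_eq_of_not_hasPoleAt {f : RatFun m} {z : Coords m}
    (h : ¬ f.HasPoleAt z) : ∃ p q : MvPolynomial (Fin (m + 1)) ℂ, eval z q ≠ 0 ∧
      algebraMap _ (RatFun m) q * f = algebraMap _ (RatFun m) p := by
  refine ⟨IsFractionRing.num _ f, IsFractionRing.den (MvPolynomial (Fin (m + 1)) ℂ) f, h, ?_⟩
  rw [mul_comm]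
  exact IsFractionRing.num_mul_den_eq_num_iff_eq.mpr rfl

end RatFun

/-! ### The polynomial connection matrix -/

section System

variable (R : Type*) [CommRing R] (n : ℕ)

/-- The index set of the system: the `n` powers of `y`, a constant, and rational functions
`h` of the coordinates, of degree `0`, with pole locus `poleFun = 0`. -/
abbrev SysIndex : Type := Fin n ⊕ (Unit ⊕ (Fin (n + 1) × Fin (n + 1)))

/-- The homogeneous polynomial defining the polar locus. -/
def polePoly : MvPolynomial (Fin (n + 1)) R := poleFun X

variable {n} in
/-- The monomials `t_k ^ N t_j`, of the same degree as `polePoly`. -/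
def poleMonomial (b : Fin (n + 1) × Fin (n + 1)) : MvPolynomial (Fin (n + 1)) R :=
  X b.1 ^ (n * (n + 1)) * X b.2

/-- The connection matrix, multiplied by `polePoly ^ 2`. -/
def connectionNum (k : Fin (n + 1)) :
    Matrix (SysIndex n) (SysIndex n) (MvPolynomial (Fin (n + 1)) R) :=
  Matrix.fromBlocks ((X 0 * polePoly R n) • powerNum X k) 0 0
    (Matrix.fromBlocks 0 0 (Matrix.of fun b _ =>
      pderiv k (poleMonomial R b) * polePoly R n - poleMonomial R b * pderiv k (polePoly R n)) 0)

variable {n}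

theorem polePoly_isHomogeneous : (polePoly R n).IsHomogeneous (n * (n + 1) + 1) :=
  poleFun_isHomogeneous R

theorem poleMonomial_isHomogeneous (b : Fin (n + 1) × Fin (n + 1)) :
    (poleMonomial R b).IsHomogeneous (n * (n + 1) + 1) :=
  (isHomogeneous_X_pow _ _).mul (isHomogeneous_X _ _)

variable {R} in
theorem map_polePoly {S : Type*} [CommRing S] (f : R →+* S) :
    map f (polePoly R n) = polePoly S n := by
  rw [polePoly, map_poleFun, polePoly]
  congr 1
  funext i
  simp

variable {R} in
theorem eval_polePoly (z : Fin (n + 1) → R) : eval z (polePoly R n) = poleFun z := by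
  rw [polePoly, map_poleFun]
  congr 1
  funext i
  simp

variable {R} in
theorem map_poleMonomial {S : Type*} [CommRing S] (f : R →+* S)
    (b : Fin (n + 1) × Fin (n + 1)) : map f (poleMonomial R b) = poleMonomial S b := by
  simp [poleMonomial]

theorem connectionNum_isHomogeneous (k : Fin (n + 1)) (i j : SysIndex n) :
    (connectionNum R n k i j).IsHomogeneous (2 * (n * (n + 1)) + 1) := by
  rcases i with i | i | i <;> rcases j with j | j | j <;>
    try exact isHomogeneous_zero _ _ _
  · have h := ((isHomogeneous_X R (0 : Fin (n + 1))).mul (polePoly_isHomogeneous R)).mul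
      (powerNum_isHomogeneous R k i j)
    -- The degrees match only for n > 0, because of the truncated n - 1; the index i supplies this.
    have hd : 2 * (n * (n + 1)) + 1 =
        1 + (n * (n + 1) + 1) + (n + (n - 1) * (n + 1)) := by
      obtain ⟨m, rfl⟩ : ∃ m, n = m + 1 := ⟨n - 1, by have := i.2; omega⟩
      simp only [Nat.add_sub_cancel]
      ring
    rw [hd]
    exact h
  · have h1 := ((poleMonomial_isHomogeneous R i).pderiv (i := k)).mul (polePoly_isHomogeneous R)
    have h2 := (poleMonomial_isHomogeneous R i).mul
      ((polePoly_isHomogeneous R (n := n)).pderiv (i := k))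
    rw [Nat.add_sub_cancel, ← add_assoc, ← two_mul] at h1
    rw [Nat.add_sub_cancel, add_right_comm, ← two_mul] at h2
    exact h1.sub h2

variable {R} in
theorem map_connectionNum {S : Type*} [CommRing S] (f : R →+* S) (k : Fin (n + 1))
    (i j : SysIndex n) : map f (connectionNum R n k i j) = connectionNum S n k i j := by
  rcases i with i | i | i <;> rcases j with j | j | j <;>
    simp only [connectionNum, Matrix.fromBlocks_apply₁₁, Matrix.fromBlocks_apply₁₂,
      Matrix.fromBlocks_apply₂₁, Matrix.fromBlocks_apply₂₂, Matrix.zero_apply, map_zero,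
      Matrix.of_apply, Matrix.smul_apply, smul_eq_mul, map_mul, map_sub, map_polePoly, map_X,
      map_poleMonomial, ← pderiv_map]
  congr 1
  have h := congrFun (congrFun (map_powerNum
    (map f : MvPolynomial (Fin (n + 1)) R →+* MvPolynomial (Fin (n + 1)) S) X k) i) j
  rw [RingHom.mapMatrix_apply, Matrix.map_apply] at h
  rw [h]
  congr 2
  funext i
  simp

theorem sum_X_mul_connectionNum [IsDomain R] (i j : SysIndex n) :
    ∑ k : Fin (n + 1), X k * connectionNum R n k i j = 0 := by
  rcases i with i | i | i <;> rcases j with j | j | j <;>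
    simp only [connectionNum, Matrix.fromBlocks_apply₁₁, Matrix.fromBlocks_apply₁₂,
      Matrix.fromBlocks_apply₂₁, Matrix.fromBlocks_apply₂₂, Matrix.zero_apply, mul_zero,
      Finset.sum_const_zero, Matrix.of_apply, Matrix.smul_apply, smul_eq_mul]
  · have h := congrFun (congrFun (sum_smul_powerNum
      (X : Fin (n + 1) → MvPolynomial (Fin (n + 1)) R) (X_ne_zero 0)) i) j
    rw [Matrix.sum_apply] at h
    simp only [Matrix.smul_apply, smul_eq_mul, Matrix.zero_apply] at h
    rw [← mul_zero ((X 0 : MvPolynomial (Fin (n + 1)) R) * polePoly R n), ← h, Finset.mul_sum]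
    exact Finset.sum_congr rfl fun k _ => by ring
  -- `poleMonomial` and `polePoly` have the same degree, so their two Euler identities cancel in the
  -- numerator of the derivative of the quotient.
  · have h1 := (poleMonomial_isHomogeneous R i).sum_X_mul_pderiv
    have h2 := (polePoly_isHomogeneous R (n := n)).sum_X_mul_pderiv
    have : ∀ k : Fin (n + 1), X k * (pderiv k (poleMonomial R i) * polePoly R n -
        poleMonomial R i * pderiv k (polePoly R n)) =
        X k * pderiv k (poleMonomial R i) * polePoly R n -
        poleMonomial R i * (X k * pderiv k (polePoly R n)) := fun k => by ring
    simp_rw [this]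
    rw [Finset.sum_sub_distrib, ← Finset.sum_mul, ← Finset.mul_sum, h1, h2]
    simp only [nsmul_eq_mul]
    ring

end System

/-! ### The Pfaffian system and its polar locus -/

section PfaffianForm

variable (n : ℕ)

/-- The number of the indices of the system. -/
abbrev sysDim : ℕ := Fintype.card (SysIndex n)

/-- The numbering of the indices of the system. -/
def sysEquiv : SysIndex n ≃ Fin (sysDim n) := Fintype.equivFin _

/-- The system satisfied by the powers of `y`. -/
def algebraicSystem : PfaffianForm n (sysDim n) where
  coeff k := Matrix.of fun i j =>
    algebraMap _ (RatFun n) (connectionNum ℂ n k ((sysEquiv n).symm i) ((sysEquiv n).symm j)) /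
      algebraMap _ (RatFun n) (polePoly ℂ n ^ 2)
  homogeneous k i j := by
    -- Nonvanishing of `polePoly` is proved only later; in the opposite case division by zero makes
    -- every entry 0.
    by_cases h : polePoly ℂ n = 0
    · exact ⟨0, 0, X 0, isHomogeneous_zero _ _ _, isHomogeneous_X _ _, X_ne_zero 0, by simp [h]⟩
    · refine ⟨2 * (n * (n + 1)) + 1, _, polePoly ℂ n ^ 2, connectionNum_isHomogeneous ℂ _ _ _, ?_,
        pow_ne_zero 2 h, rfl⟩
      have h := (polePoly_isHomogeneous ℂ (n := n)).pow 2
      rwa [add_mul, mul_comm _ 2, one_mul] at h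
  euler i j := by
    have h := congrArg (algebraMap _ (RatFun n))
      (sum_X_mul_connectionNum ℂ ((sysEquiv n).symm i) ((sysEquiv n).symm j))
    simp only [map_sum, map_mul, map_zero] at h
    simp only [Matrix.of_apply, ← mul_div_assoc]
    rw [← Finset.sum_div, h, zero_div]

variable {n}

theorem algebraicSystem_isDefinedOverRat (h : polePoly ℤ n ≠ 0) :
    (algebraicSystem n).IsDefinedOverRat := by
  intro k i j
  refine ⟨connectionNum ℤ n k ((sysEquiv n).symm i) ((sysEquiv n).symm j), polePoly ℤ n ^ 2,
    pow_ne_zero 2 h, ?_⟩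
  rw [map_connectionNum, map_pow, map_polePoly]
  rfl

theorem algebraicSystem_coeffAt {z : Coords n} (hz : poleFun z ≠ 0) (k : Fin (n + 1)) :
    (algebraicSystem n).coeffAt k z =
      Matrix.of fun i j => eval z (connectionNum ℂ n k ((sysEquiv n).symm i) ((sysEquiv n).symm j))
        / poleFun z ^ 2 := by
  ext i j
  have hz' : eval z (polePoly ℂ n ^ 2) ≠ 0 := by
    rw [map_pow, eval_polePoly]
    exact pow_ne_zero 2 hz
  rw [← eval_polePoly, ← map_pow]
  exact (RatFun.value_div hz').2

theorem not_hasPoleAt_of_poleFun_ne_zero {z : Coords n} (hz : poleFun z ≠ 0) (k : Fin (n + 1))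
    (i j : Fin (sysDim n)) : ¬ ((algebraicSystem n).coeff k i j).HasPoleAt z := by
  have hz' : eval z (polePoly ℂ n ^ 2) ≠ 0 := by
    rw [map_pow, eval_polePoly]
    exact pow_ne_zero 2 hz
  exact (RatFun.value_div hz').1

/-- With z_k ≠ 0 and j ≠ k, consider the j-th derivatives of the added functions h_kk = t_k^{N+1} /
G and h_kj = t_k^N t_j / G. Eliminating ∂_j G between them leaves t_k^{2N+1} / G, which has a pole
at z, so one of the two derivatives does. -/
theorem exists_hasPoleAt_of_poleFun_eq_zero (hn : 1 ≤ n) (h0 : polePoly ℂ n ≠ 0) {z : Coords n}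
    (hz : z ≠ 0) (hpz : poleFun z = 0) :
    ∃ k i j, ((algebraicSystem n).coeff k i j).HasPoleAt z := by
  by_contra! hno
  obtain ⟨k, hk⟩ : ∃ k, z k ≠ 0 := Function.ne_iff.mp hz
  have : Nontrivial (Fin (n + 1)) := Fin.nontrivial_iff_two_le.mpr (by omega)
  obtain ⟨j, hj⟩ := exists_ne k
  let f : Fin (n + 1) × Fin (n + 1) → RatFun n := fun b =>
    (algebraicSystem n).coeff j (sysEquiv n (Sum.inr (Sum.inr b)))
      (sysEquiv n (Sum.inr (Sum.inl ())))
  have hG0 : algebraMap _ (RatFun n) (polePoly ℂ n) ≠ 0 := by simpa using h0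
  have hf : ∀ b, f b = algebraMap _ (RatFun n)
      (pderiv j (poleMonomial ℂ b) * polePoly ℂ n - poleMonomial ℂ b * pderiv j (polePoly ℂ n)) /
        algebraMap _ (RatFun n) (polePoly ℂ n ^ 2) := by
    intro b
    simp [f, algebraicSystem, connectionNum]
  obtain ⟨p₁, q₁, hq₁, h₁⟩ := RatFun.exists_mul_eq_of_not_hasPoleAt
    (hno j (sysEquiv n (Sum.inr (Sum.inr (k, k)))) (sysEquiv n (Sum.inr (Sum.inl ()))))
  obtain ⟨p₂, q₂, hq₂, h₂⟩ := RatFun.exists_mul_eq_of_not_hasPoleAt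
    (hno j (sysEquiv n (Sum.inr (Sum.inr (k, j)))) (sysEquiv n (Sum.inr (Sum.inl ()))))
  change _ * f (k, k) = _ at h₁
  change _ * f (k, j) = _ at h₂
  have hd1 : pderiv j (poleMonomial ℂ (k, k)) = 0 := by
    simp [poleMonomial, pderiv_X_of_ne hj.symm]
  have hd2 : pderiv j (poleMonomial ℂ (k, j)) = X k ^ (n * (n + 1)) := by
    simp [poleMonomial, pderiv_X_of_ne hj.symm]
  rw [hf, hd1] at h₁
  rw [hf, hd2] at h₂
  -- This is t_k^{N+1} ∂_j h_kj - t_k^N t_j ∂_j h_kk = t_k^{2N+1} / G with denominators cleared. At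
  -- z the left side is nonzero and the right side vanishes.
  have key : q₁ * q₂ * (X k ^ (n * (n + 1)) * X k ^ (n * (n + 1) + 1)) = polePoly ℂ n *
      (poleMonomial ℂ (k, k) * p₂ * q₁ - poleMonomial ℂ (k, j) * p₁ * q₂) := by
    apply IsFractionRing.injective (MvPolynomial (Fin (n + 1)) ℂ) (RatFun n)
    simp only [map_mul, map_sub, map_pow, poleMonomial, ← h₁, ← h₂, map_zero]
    field_simp
    ring
  have := congrArg (eval z) key
  simp only [map_mul, map_pow, eval_X, eval_polePoly, hpz, zero_mul] at this
  simp [hq₁, hq₂, hk] at this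

theorem mem_regularSet_iff (hn : 1 ≤ n) (h0 : polePoly ℂ n ≠ 0) {z : Coords n} :
    z ∈ (algebraicSystem n).regularSet ↔ poleFun z ≠ 0 := by
  constructor
  · rintro ⟨hz, hz'⟩ hp
    exact hz' ⟨hz, exists_hasPoleAt_of_poleFun_eq_zero hn h0 hz hp⟩
  · intro hp
    refine ⟨?_, ?_⟩
    · rintro rfl
      simp [poleFun] at hp
    · rintro ⟨-, k, i, j, h⟩
      exact not_hasPoleAt_of_poleFun_ne_zero hp k i j h

theorem mem_polarLocus_iff (hn : 1 ≤ n) (h0 : polePoly ℂ n ≠ 0) {z : Coords n} :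
    z ∈ (algebraicSystem n).polarLocus ↔ z ≠ 0 ∧ poleFun z = 0 := by
  constructor
  · rintro ⟨hz, k, i, j, h⟩
    exact ⟨hz, by_contra fun hp => not_hasPoleAt_of_poleFun_ne_zero hp k i j h⟩
  · rintro ⟨hz, hp⟩
    exact ⟨hz, exists_hasPoleAt_of_poleFun_eq_zero hn h0 hz hp⟩

end PfaffianForm

end MvPolynomial

/-! ### Numberings of the roots -/

section Roots

variable {n : ℕ}

/-- `y` is a numbering of the roots of the general polynomial with coefficients `w`. -/
def IsRootSystem (w : Coords n) (y : Fin n → ℂ) : Prop :=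
  ∀ T : ℂ, generalPoly w T = w 0 * ∏ j, (T - y j)

theorem IsRootSystem.isRoot {w : Coords n} {y : Fin n → ℂ} (h : IsRootSystem w y) (j : Fin n) :
    generalPoly w (y j) = 0 := by
  rw [h, Finset.prod_eq_zero (Finset.mem_univ j) (sub_self _), mul_zero]

theorem IsRootSystem.exists_eq {w : Coords n} {y : Fin n → ℂ} (h : IsRootSystem w y)
    (h0 : w 0 ≠ 0) {T : ℂ} (hT : generalPoly w T = 0) : ∃ j, T = y j := by
  rw [h, mul_eq_zero, or_iff_right h0, Finset.prod_eq_zero_iff] at hT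
  obtain ⟨j, -, hj⟩ := hT
  exact ⟨j, sub_eq_zero.mp hj⟩

/-- The general polynomial with coefficients `w`, as a polynomial. -/
def toPolynomial (w : Coords n) : Polynomial ℂ :=
  ∑ i : Fin (n + 1), Polynomial.C (w i) * Polynomial.X ^ (n - (i : ℕ))

theorem eval_toPolynomial (w : Coords n) (T : ℂ) :
    (toPolynomial w).eval T = generalPoly w T := by
  simp [toPolynomial, generalPoly, Polynomial.eval_finsetSum]

theorem coeff_toPolynomial_sub (w : Coords n) (k : Fin (n + 1)) :
    (toPolynomial w).coeff (n - (k : ℕ)) = w k := by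
  simp only [toPolynomial, Polynomial.finsetSum_coeff, Polynomial.coeff_C_mul,
    Polynomial.coeff_X_pow]
  rw [Finset.sum_eq_single k]
  · simp
  · intro i _ hi
    have : (i : ℕ) ≠ k := fun h => hi (Fin.ext h)
    rw [if_neg (by omega), mul_zero]
  · simp

theorem coeff_toPolynomial (w : Coords n) : (toPolynomial w).coeff n = w 0 := by
  simpa using coeff_toPolynomial_sub w 0

theorem natDegree_toPolynomial_le (w : Coords n) : (toPolynomial w).natDegree ≤ n :=
  Polynomial.natDegree_sum_le_of_forall_le _ _ fun _ _ =>
    (Polynomial.natDegree_C_mul_X_pow_le _ _).trans (Nat.sub_le _ _)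

/-- The derivative of the general polynomial. -/
def derivPoly (w : Coords n) (y : ℂ) : ℂ :=
  ∑ i : Fin (n + 1), w i * (((n - (i : ℕ) : ℕ) : ℂ) * y ^ (n - (i : ℕ) - 1))

theorem mul_derivPoly (w : Coords n) (y : ℂ) : y * derivPoly w y = eulerPoly w y := by
  rw [derivPoly, eulerPoly, Finset.mul_sum]
  refine Finset.sum_congr rfl fun i _ => ?_
  rcases Nat.eq_zero_or_pos (n - (i : ℕ)) with h | h
  · simp [h]
  · obtain ⟨m, hm⟩ : ∃ m, n - (i : ℕ) = m + 1 := ⟨n - i - 1, by omega⟩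
    rw [hm, Nat.add_sub_cancel]
    ring

theorem hasDerivAt_generalPoly (w : Coords n) (y : ℂ) :
    HasDerivAt (generalPoly w) (derivPoly w y) y := by
  unfold generalPoly derivPoly
  refine HasDerivAt.fun_sum fun i _ => ?_
  have := (hasDerivAt_pow (n - (i : ℕ)) y).const_mul (w i)
  exact this

theorem IsRootSystem.derivPoly_eq {w : Coords n} {y : Fin n → ℂ} (h : IsRootSystem w y)
    (j : Fin n) : derivPoly w (y j) = w 0 * ∏ i ∈ Finset.univ.erase j, (y j - y i) := by
  have h1 := hasDerivAt_generalPoly w (y j)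
  have h2 : HasDerivAt (fun T : ℂ => w 0 * ∏ i, (T - y i))
      (w 0 * ∑ i, (∏ k ∈ Finset.univ.erase i, (y j - y k)) • (1 : ℂ)) (y j) :=
    (HasDerivAt.fun_finsetProd fun i _ => (hasDerivAt_id' (y j)).sub_const (y i)).const_mul _
  have h3 : generalPoly w = fun T : ℂ => w 0 * ∏ i, (T - y i) := funext h
  rw [← h3] at h2
  rw [h1.unique h2, Finset.sum_eq_single j]
  · simp
  · intro i _ hij
    rw [Finset.prod_eq_zero (Finset.mem_erase.mpr ⟨hij.symm, Finset.mem_univ j⟩) (sub_self _),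
      zero_smul]
  · simp

/-- det E is a multiple of y P'(y), by the first coordinate of the adjugate identity. -/
theorem eulerPoly_ne_zero (hn : 1 ≤ n) {w : Coords n} (hw : poleFun w ≠ 0) {y : ℂ}
    (hy : generalPoly w y = 0) : eulerPoly w y ≠ 0 := by
  intro h
  have h1 := congrFun (adjugate_eulerMatrix_mulVec hy) ⟨0, hn⟩
  simp only [h, mul_zero, Pi.smul_apply, pow_zero, smul_eq_mul, mul_one, zero_mul] at h1
  exact hw (by rw [poleFun, ← h1, mul_zero])

theorem derivPoly_ne_zero (hn : 1 ≤ n) {w : Coords n} (hw : poleFun w ≠ 0) {y : ℂ}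
    (hy : generalPoly w y = 0) : derivPoly w y ≠ 0 := by
  have := eulerPoly_ne_zero hn hw hy
  rw [← mul_derivPoly] at this
  exact right_ne_zero_of_mul this

theorem IsRootSystem.injective (hn : 1 ≤ n) {w : Coords n} (hw : poleFun w ≠ 0) {y : Fin n → ℂ}
    (h : IsRootSystem w y) : Function.Injective y := by
  intro i j hij
  by_contra hne
  have h1 := derivPoly_ne_zero hn hw (h.isRoot i)
  rw [h.derivPoly_eq, Finset.prod_eq_zero (i := j), mul_zero] at h1
  · exact h1 rfl
  · exact Finset.mem_erase.mpr ⟨fun h => hne h.symm, Finset.mem_univ j⟩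
  · rw [hij, sub_self]

/-- Both sides are polynomials of degree at most n with the same coefficient of degree n, so their
difference has degree below n while vanishing at n distinct points. -/
theorem IsRootSystem.of_injective {w : Coords n} {y : Fin n → ℂ} (hy : Function.Injective y)
    (h : ∀ j, generalPoly w (y j) = 0) : IsRootSystem w y := by
  let q : Polynomial ℂ := Polynomial.C (w 0) * ∏ j, (Polynomial.X - Polynomial.C (y j))
  have hq : ∀ T, q.eval T = w 0 * ∏ j, (T - y j) := by
    intro T
    simp [q, Polynomial.eval_prod]
  suffices toPolynomial w = q by
    intro T
    rw [← eval_toPolynomial, ← hq, this]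
  have hmonic : (∏ j, (Polynomial.X - Polynomial.C (y j))).Monic :=
    Polynomial.monic_prod_of_monic _ _ fun j _ => Polynomial.monic_X_sub_C _
  have hdeg : (∏ j, (Polynomial.X - Polynomial.C (y j))).natDegree = n := by
    rw [Polynomial.natDegree_prod_of_monic _ _ fun j _ => Polynomial.monic_X_sub_C _]
    simp
  have hqn : q.coeff n = w 0 := by
    have := hmonic.coeff_natDegree
    rw [hdeg] at this
    simp [q, Polynomial.coeff_C_mul, this]
  have hqd : q.natDegree ≤ n := (Polynomial.natDegree_C_mul_le _ _).trans hdeg.le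
  refine sub_eq_zero.mp (Polynomial.eq_zero_of_degree_lt_of_eval_index_eq_zero Finset.univ
    hy.injOn ?_ fun j _ => ?_)
  · rw [Finset.card_univ, Fintype.card_fin]
    refine (Polynomial.degree_lt_iff_coeff_zero _ _).mpr fun m hm => ?_
    rcases hm.eq_or_lt with rfl | hm
    · rw [Polynomial.coeff_sub, coeff_toPolynomial, hqn, sub_self]
    · rw [Polynomial.coeff_sub,
        Polynomial.coeff_eq_zero_of_natDegree_lt ((natDegree_toPolynomial_le w).trans_lt hm),
        Polynomial.coeff_eq_zero_of_natDegree_lt (hqd.trans_lt hm), sub_self]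
  · rw [Polynomial.eval_sub, eval_toPolynomial, hq, h,
      Finset.prod_eq_zero (Finset.mem_univ j) (sub_self _)]
    simp

theorem exists_isRootSystem {w : Coords n} (h0 : w 0 ≠ 0) : ∃ y, IsRootSystem w y := by
  set p := toPolynomial w with hp
  have hpn : p.coeff n = w 0 := coeff_toPolynomial w
  have hd : p.natDegree = n := (natDegree_toPolynomial_le w).antisymm
    (Polynomial.le_natDegree_of_ne_zero (by rwa [coeff_toPolynomial]))
  have hs := IsAlgClosed.splits p
  have hcard : p.roots.toList.length = n := by
    rw [Multiset.length_toList, ← hd]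
    exact hs.natDegree_eq_card_roots.symm
  refine ⟨fun j => p.roots.toList.get (j.cast hcard.symm), fun T => ?_⟩
  have h1 := hs.eq_prod_roots
  have h2 : p.eval T = p.leadingCoeff * (p.roots.toList.map fun a => T - a).prod := by
    conv_lhs => rw [h1]
    rw [Polynomial.eval_mul, Polynomial.eval_C, Polynomial.eval_multiset_prod]
    congr 1
    conv_lhs => rw [← Multiset.coe_toList p.roots]
    simp
  rw [← eval_toPolynomial, ← hp, h2, Polynomial.leadingCoeff, hd, hpn]
  congr 1
  rw [← List.prod_ofFn]
  congr 1
  apply List.ext_get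
  · simp [hcard]
  · intro i h1 h2
    simp

theorem IsRootSystem.comp_perm {w : Coords n} {y : Fin n → ℂ} (h : IsRootSystem w y)
    (s : Equiv.Perm (Fin n)) : IsRootSystem w (y ∘ s) := by
  intro T
  rw [h T, ← Equiv.prod_comp s]
  rfl

theorem IsRootSystem.exists_perm (hn : 1 ≤ n) {w : Coords n} (hw : poleFun w ≠ 0)
    {y y' : Fin n → ℂ} (h : IsRootSystem w y) (h' : IsRootSystem w y') :
    ∃ s : Equiv.Perm (Fin n), y' = y ∘ s := by
  have h0 : w 0 ≠ 0 := left_ne_zero_of_mul hw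
  choose s hs using fun j => h.exists_eq h0 (h'.isRoot j)
  have hinj : Function.Injective s := fun i j hij =>
    h'.injective hn hw (by rw [hs i, hs j, hij])
  exact ⟨Equiv.ofBijective s (Finite.injective_iff_bijective.mp hinj), funext hs⟩

theorem exists_isRootSystem_apply_zero (hn : 1 ≤ n) {w : Coords n} (hw : poleFun w ≠ 0) {T : ℂ}
    (hT : generalPoly w T = 0) : ∃ y, IsRootSystem w y ∧ y ⟨0, hn⟩ = T := by
  have h0 : w 0 ≠ 0 := left_ne_zero_of_mul hw
  obtain ⟨y, hy⟩ := exists_isRootSystem h0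
  obtain ⟨j, hj⟩ := hy.exists_eq h0 hT
  exact ⟨_, hy.comp_perm (Equiv.swap ⟨0, hn⟩ j), by simp [hj]⟩

end Roots

/-! ### Analytic dependence of a root on the coefficients -/

section Analytic

variable {n : ℕ}

theorem analyticAt_generalPoly_comp {E : Type*} [NormedAddCommGroup E] [NormedSpace ℂ E]
    {f : E → Coords n} {Y : E → ℂ} {z : E} (hf : AnalyticAt ℂ f z) (hY : AnalyticAt ℂ Y z) :
    AnalyticAt ℂ (fun w => generalPoly (f w) (Y w)) z := by
  unfold generalPoly
  refine Finset.analyticAt_fun_sum _ fun i _ => ?_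
  have hi : AnalyticAt ℂ (fun w => f w i) z :=
    ((ContinuousLinearMap.proj (R := ℂ) (φ := fun _ : Fin (n + 1) => ℂ) i).analyticAt _).comp hf
  exact hi.mul (hY.pow _)

/-- The implicit function theorem at a simple root. Uniqueness is stated jointly in the coefficients
and the root, so that it applies to any continuous choice of root. -/
theorem exists_analyticAt_root {z : Coords n} {y : ℂ} (hy : generalPoly z y = 0)
    (hd : derivPoly z y ≠ 0) : ∃ φ : Coords n → ℂ, AnalyticAt ℂ φ z ∧ φ z = y ∧
      ∀ᶠ p : Coords n × ℂ in 𝓝 (z, y), generalPoly p.1 p.2 = 0 ↔ p.2 = φ p.1 := by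
  let f : Coords n × ℂ → ℂ := fun p => generalPoly p.1 p.2
  have hf : ContDiffAt ℂ ⊤ f (z, y) :=
    (analyticAt_generalPoly_comp analyticAt_fst analyticAt_snd).contDiffAt
  have hinv : (fderiv ℂ f (z, y) ∘L .inr ℂ (Coords n) ℂ).IsInvertible := by
    refine ⟨ContinuousLinearEquiv.unitsEquivAut ℂ (Units.mk0 _ hd), ?_⟩
    ext
    have h1 : HasFDerivAt f (fderiv ℂ f (z, y)) (z, y) :=
      (hf.differentiableAt (by simp)).hasFDerivAt
    have h2 : HasDerivAt (fun T : ℂ => (z, T)) ((0 : Coords n), (1 : ℂ)) y :=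
      (hasDerivAt_const y z).prodMk (hasDerivAt_id y)
    have h3 := h1.comp_hasDerivAt y h2
    have h4 := h3.unique (hasDerivAt_generalPoly z y)
    simp [h4]
  refine ⟨hf.implicitFunction (by simp) hinv, ?_, hf.implicitFunction_apply_self _ hinv, ?_⟩
  · exact (hf.contDiffAt_implicitFunction (by simp) hinv).analyticAt
  · filter_upwards [hf.eventually_apply_eq_iff_implicitFunction (by simp) hinv] with p hp
    have : f (z, y) = 0 := hy
    rw [this] at hp
    exact hp.trans eq_comm

theorem hasDerivAt_partialDeriv {f : Coords n → ℂ} {z : Coords n} (hf : DifferentiableAt ℂ f z)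
    (k : Fin (n + 1)) :
    HasDerivAt (fun s : ℂ => f (z + s • Pi.single k 1)) (partialDeriv k f z) 0 := by
  have h1 : HasDerivAt (fun s : ℂ => z + s • (Pi.single k 1 : Coords n)) (Pi.single k 1) 0 := by
    simpa using ((hasDerivAt_id (0 : ℂ)).smul_const (Pi.single k 1 : Coords n)).const_add z
  have h2 : HasFDerivAt f (fderiv ℂ f z) (z + (0 : ℂ) • Pi.single k 1) := by
    simpa using hf.hasFDerivAt
  exact h2.comp_hasDerivAt 0 h1

theorem derivPoly_mul_partialDeriv {Y : Coords n → ℂ} {z : Coords n} (hY : AnalyticAt ℂ Y z)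
    (h : ∀ᶠ w in 𝓝 z, generalPoly w (Y w) = 0) (k : Fin (n + 1)) :
    derivPoly z (Y z) * partialDeriv k Y z = -Y z ^ (n - (k : ℕ)) := by
  have h1 := hasDerivAt_partialDeriv hY.differentiableAt k
  have h2 : HasDerivAt (fun s : ℂ => generalPoly (z + s • (Pi.single k 1 : Coords n))
      (Y (z + s • Pi.single k 1)))
      (∑ i : Fin (n + 1), ((Pi.single k 1 : Coords n) i * Y z ^ (n - (i : ℕ)) +
        z i * (((n - (i : ℕ) : ℕ) : ℂ) * Y z ^ (n - (i : ℕ) - 1) * partialDeriv k Y z))) 0 := by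
    unfold generalPoly
    refine HasDerivAt.fun_sum fun i _ => ?_
    have h3 : HasDerivAt (fun s : ℂ => (z + s • (Pi.single k 1 : Coords n)) i)
        ((Pi.single k 1 : Coords n) i) 0 := by
      simpa using ((hasDerivAt_id (0 : ℂ)).mul_const ((Pi.single k 1 : Coords n) i)).const_add (z i)
    simpa using h3.fun_mul (h1.fun_pow (n - (i : ℕ)))
  have h3 : HasDerivAt (fun s : ℂ => generalPoly (z + s • (Pi.single k 1 : Coords n))
      (Y (z + s • Pi.single k 1))) 0 0 := by
    refine (hasDerivAt_const (0 : ℂ) (0 : ℂ)).congr_of_eventuallyEq ?_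
    have hc : ContinuousAt (fun s : ℂ => z + s • (Pi.single k 1 : Coords n)) 0 := by fun_prop
    have := hc.eventually (p := fun w => generalPoly w (Y w) = 0) (by simpa using h)
    exact this
  have h4 := h2.unique h3
  rw [Finset.sum_add_distrib, Finset.sum_eq_single k (by
    intro i _ hi
    rw [Pi.single_eq_of_ne hi, zero_mul]) (by simp)] at h4
  rw [Pi.single_eq_same, one_mul] at h4
  rw [derivPoly, Finset.sum_mul]
  rw [eq_neg_iff_add_eq_zero, add_comm, ← h4]
  congr 1
  exact Finset.sum_congr rfl fun i _ => by ring

theorem differentiableAt_eval_and_partialDeriv (p : MvPolynomial (Fin (n + 1)) ℂ) (z : Coords n) :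
    DifferentiableAt ℂ (fun w : Coords n => MvPolynomial.eval w p) z ∧ ∀ k,
      partialDeriv k (fun w : Coords n => MvPolynomial.eval w p) z =
        MvPolynomial.eval z (MvPolynomial.pderiv k p) := by
  induction p using MvPolynomial.induction_on with
  | C a => simp [partialDeriv]
  | add p q hp hq =>
    simp only [map_add]
    refine ⟨hp.1.add hq.1, fun k => ?_⟩
    rw [← hp.2, ← hq.2, partialDeriv, fderiv_fun_add hp.1 hq.1]
    rfl
  | mul_X p i hp =>
    have hX : DifferentiableAt ℂ (fun w : Coords n => w i) z := by fun_prop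
    have hXf : fderiv ℂ (fun w : Coords n => w i) z = ContinuousLinearMap.proj i :=
      (ContinuousLinearMap.proj (R := ℂ) (φ := fun _ : Fin (n + 1) => ℂ) i).fderiv
    simp only [map_mul, MvPolynomial.eval_X]
    refine ⟨hp.1.mul hX, fun k => ?_⟩
    rw [partialDeriv, fderiv_fun_mul hp.1 hX, hXf, MvPolynomial.pderiv_mul]
    simp only [add_apply, smul_apply, map_add, map_mul,
      ← hp.2, ContinuousLinearMap.proj_apply, MvPolynomial.eval_X]
    rw [MvPolynomial.pderiv_X, partialDeriv]
    by_cases hki : i = k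
    · subst hki
      simp
      ring
    · simp [Pi.single_eq_of_ne hki]
      ring

theorem analyticAt_eval (p : MvPolynomial (Fin (n + 1)) ℂ) (z : Coords n) :
    AnalyticAt ℂ (fun w : Coords n => MvPolynomial.eval w p) z := by
  have := AnalyticAt.aeval_mvPolynomial (𝕜 := ℂ) (z := z) (f := fun w : Coords n => w)
    (fun i => (ContinuousLinearMap.proj (R := ℂ) (φ := fun _ : Fin (n + 1) => ℂ) i).analyticAt z) p
  simpa [MvPolynomial.aeval_eq_eval] using this

end Analytic

/-! ### The fundamental matrix over a commutative ring -/

section SysMatrix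

variable {R : Type*} [CommRing R] {n : ℕ}

/-- The fundamental matrix of the system, in terms of the roots `y` and the rational functions
`h`. -/
def sysMatrix (y : Fin n → R) (h : Fin (n + 1) × Fin (n + 1) → R) :
    Matrix (SysIndex n) (SysIndex n) R :=
  Matrix.fromBlocks (Matrix.of fun i j => y j ^ ((i : ℕ) + 1)) 0 0
    (Matrix.fromBlocks 1 0 (Matrix.of fun b _ => h b) 1)

theorem map_sysMatrix {S : Type*} [CommRing S] (f : R →+* S) (y : Fin n → R)
    (h : Fin (n + 1) × Fin (n + 1) → R) :
    f.mapMatrix (sysMatrix y h) = sysMatrix (f ∘ y) (f ∘ h) := by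
  ext i j
  rcases i with i | i | i <;> rcases j with j | j | j <;>
    simp [sysMatrix, Matrix.one_apply, apply_ite f]

theorem det_sysMatrix (y : Fin n → R) (h : Fin (n + 1) × Fin (n + 1) → R) :
    (sysMatrix y h).det = (∏ j, y j) * ∏ i : Fin n, ∏ j ∈ Finset.Ioi i, (y j - y i) := by
  have hV : (Matrix.of fun i j : Fin n => y j ^ ((i : ℕ) + 1)) =
      (Matrix.of fun i j : Fin n => y i * Matrix.vandermonde y i j).transpose := by
    ext i j
    simp [Matrix.vandermonde_apply, pow_succ']
  rw [sysMatrix, Matrix.det_fromBlocks_zero₁₂, Matrix.det_fromBlocks_zero₁₂, Matrix.det_one,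
    Matrix.det_one, mul_one, mul_one, hV, Matrix.det_transpose, Matrix.det_mul_column,
    Matrix.det_vandermonde]

/-- Reordering the roots multiplies the fundamental matrix by a permutation matrix. -/
theorem sysMatrix_comp_perm (y : Fin n → R) (h : Fin (n + 1) × Fin (n + 1) → R)
    (s : Equiv.Perm (Fin n)) : sysMatrix (y ∘ s) h =
      (sysMatrix y h).submatrix id (Equiv.sumCongr s (Equiv.refl _)) := by
  ext i j
  rcases i with i | i | i <;> rcases j with j | j | j <;> simp [sysMatrix]

end SysMatrix

/-! ### Local fundamental solutions from the roots -/

section Local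

variable {n : ℕ}

/-- The value of a rational function of degree `0` with poles along the polar locus. -/
def poleRatio (w : Coords n) (b : Fin (n + 1) × Fin (n + 1)) : ℂ :=
  MvPolynomial.eval w (poleMonomial ℂ b) / poleFun w

/-- The fundamental matrix at `w`, for the numbering `y` of the roots. -/
def fundMatrix (w : Coords n) (y : Fin n → ℂ) : Matrix (Fin (sysDim n)) (Fin (sysDim n)) ℂ :=
  (sysMatrix y (poleRatio w)).submatrix (sysEquiv n).symm (sysEquiv n).symm

theorem analyticAt_poleFun (z : Coords n) : AnalyticAt ℂ (fun w : Coords n => poleFun w) z := by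
  have := analyticAt_eval (polePoly ℂ n) z
  simpa only [eval_polePoly] using this

theorem eventually_poleFun_ne_zero {z : Coords n} (hz : poleFun z ≠ 0) :
    ∀ᶠ w in 𝓝 z, poleFun w ≠ 0 :=
  (analyticAt_poleFun z).continuousAt.eventually_ne hz

theorem analyticAt_poleRatio {z : Coords n} (hz : poleFun z ≠ 0) (b) :
    AnalyticAt ℂ (fun w => poleRatio w b) z :=
  (analyticAt_eval _ z).fun_div (analyticAt_poleFun z) hz

theorem partialDeriv_eq_of_hasDerivAt {f : Coords n → ℂ} {z : Coords n} {k : Fin (n + 1)} {c : ℂ}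
    (hf : DifferentiableAt ℂ f z)
    (h : HasDerivAt (fun s : ℂ => f (z + s • Pi.single k 1)) c 0) : partialDeriv k f z = c :=
  (hasDerivAt_partialDeriv hf k).unique h

theorem partialDeriv_poleRatio {z : Coords n} (hz : poleFun z ≠ 0) (b) (k : Fin (n + 1)) :
    partialDeriv k (fun w => poleRatio w b) z =
      MvPolynomial.eval z (MvPolynomial.pderiv k (poleMonomial ℂ b) * polePoly ℂ n -
        poleMonomial ℂ b * MvPolynomial.pderiv k (polePoly ℂ n)) / poleFun z ^ 2 := by
  refine partialDeriv_eq_of_hasDerivAt (analyticAt_poleRatio hz b).differentiableAt ?_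
  obtain ⟨h1, h1'⟩ := differentiableAt_eval_and_partialDeriv (poleMonomial ℂ b) z
  obtain ⟨h2, h2'⟩ := differentiableAt_eval_and_partialDeriv (polePoly ℂ n) z
  have h3 := (hasDerivAt_partialDeriv h1 k).fun_div (hasDerivAt_partialDeriv h2 k)
    (by simpa [eval_polePoly] using hz)
  rw [h1', h2'] at h3
  simpa [eval_polePoly, poleRatio] using h3

/-- `Y` is an analytic numbering of the roots near `z`. -/
structure IsRootGerm (z : Coords n) (Y : Coords n → Fin n → ℂ) : Prop where
  analyticAt : ∀ j, AnalyticAt ℂ (fun w => Y w j) z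
  isRootSystem : ∀ᶠ w in 𝓝 z, IsRootSystem w (Y w)

theorem IsRootGerm.eventually {z : Coords n} {Y : Coords n → Fin n → ℂ} (h : IsRootGerm z Y) :
    ∀ᶠ w in 𝓝 z, IsRootGerm w Y := by
  filter_upwards [eventually_all.mpr fun j => (h.analyticAt j).eventually_analyticAt,
    h.isRootSystem.eventually_nhds] with w h1 h2
  exact ⟨h1, h2⟩

theorem IsRootGerm.continuousAt {z : Coords n} {Y : Coords n → Fin n → ℂ} (h : IsRootGerm z Y) :
    ContinuousAt Y z :=
  continuousAt_pi.mpr fun j => (h.analyticAt j).continuousAt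

/-- Each root is continued by the implicit function theorem. The continued roots stay distinct by
continuity, and n distinct roots form a complete numbering. -/
theorem exists_isRootGerm (hn : 1 ≤ n) {z : Coords n} (hz : poleFun z ≠ 0) {y : Fin n → ℂ}
    (hy : IsRootSystem z y) : ∃ Y : Coords n → Fin n → ℂ, IsRootGerm z Y ∧ Y z = y ∧
      ∀ᶠ p : Coords n × (Fin n → ℂ) in 𝓝 (z, y), IsRootSystem p.1 p.2 → p.2 = Y p.1 := by
  choose φ hφ hφz hφu using fun j =>
    exists_analyticAt_root (hy.isRoot j) (derivPoly_ne_zero hn hz (hy.isRoot j))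
  let Y : Coords n → Fin n → ℂ := fun w j => φ j w
  have hYz : Y z = y := funext hφz
  refine ⟨Y, ⟨hφ, ?_⟩, hYz, ?_⟩
  · have h1 : ∀ᶠ w in 𝓝 z, ∀ j, generalPoly w (Y w j) = 0 := by
      refine eventually_all.mpr fun j => ?_
      have hc : Tendsto (fun w => (w, Y w j)) (𝓝 z) (𝓝 (z, y j)) := by
        rw [← hφz j]
        exact (continuousAt_id.prodMk (hφ j).continuousAt)
      filter_upwards [hc.eventually (hφu j)] with w hw
      exact hw.mpr rfl
    have hinj : ∀ᶠ w in 𝓝 z, Function.Injective (Y w) := by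
      have : ∀ᶠ w in 𝓝 z, ∀ i j, i ≠ j → Y w i ≠ Y w j := by
        refine eventually_all.mpr fun i => eventually_all.mpr fun j => ?_
        by_cases hij : i = j
        · simp [hij]
        · have hne : Y z i ≠ Y z j := fun h => hij (hy.injective hn hz (by rwa [hYz] at h))
          filter_upwards [((hφ i).continuousAt.sub (hφ j).continuousAt).eventually_ne
            (sub_ne_zero.mpr hne)] with w hw _ using sub_ne_zero.mp hw
      filter_upwards [this] with w hw i j hij
      by_contra hne
      exact hw i j hne hij
    filter_upwards [h1, hinj] with w hw hw' using IsRootSystem.of_injective hw' hw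
  · have : ∀ᶠ p : Coords n × (Fin n → ℂ) in 𝓝 (z, y), ∀ j,
        generalPoly p.1 (p.2 j) = 0 ↔ p.2 j = φ j p.1 := by
      refine eventually_all.mpr fun j => ?_
      have hc : Tendsto (fun p : Coords n × (Fin n → ℂ) => (p.1, p.2 j)) (𝓝 (z, y))
          (𝓝 (z, y j)) := by
        have : Continuous (fun p : Coords n × (Fin n → ℂ) => (p.1, p.2 j)) := by fun_prop
        exact this.tendsto (z, y)
      exact hc.eventually (hφu j)
    filter_upwards [this] with p hp hr
    exact funext fun j => (hp j).mp (hr.isRoot j)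

theorem analyticAt_fundMatrix {z : Coords n} (hz : poleFun z ≠ 0) {Y : Coords n → Fin n → ℂ}
    (hY : ∀ j, AnalyticAt ℂ (fun w => Y w j) z) (i j : Fin (sysDim n)) :
    AnalyticAt ℂ (fun w => fundMatrix w (Y w) i j) z := by
  simp only [fundMatrix, Matrix.submatrix_apply]
  generalize (sysEquiv n).symm i = i
  generalize (sysEquiv n).symm j = j
  rcases i with i | i | i <;> rcases j with j | j | j <;>
    simp only [sysMatrix, Matrix.fromBlocks_apply₁₁, Matrix.fromBlocks_apply₁₂,
      Matrix.fromBlocks_apply₂₁, Matrix.fromBlocks_apply₂₂, Matrix.of_apply] <;>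
    try exact analyticAt_const
  · exact (hY j).pow _
  · exact analyticAt_poleRatio hz _

theorem partialDeriv_const (c : ℂ) (z : Coords n) (k : Fin (n + 1)) :
    partialDeriv k (fun _ => c) z = 0 := by
  simp [partialDeriv]

/-- Implicit differentiation computes P'(y) ∂_k y. Multiplied by y, it meets the division-free
identity for `powerNum`, and the nonzero factors t_0^n and y P'(y) cancel. -/
theorem partialDeriv_root_pow (hn : 1 ≤ n) {z : Coords n} (hz : poleFun z ≠ 0)
    {Y : Coords n → ℂ} (hY : AnalyticAt ℂ Y z) (h : ∀ᶠ w in 𝓝 z, generalPoly w (Y w) = 0)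
    (k : Fin (n + 1)) (i : Fin n) :
    partialDeriv k (fun w => Y w ^ ((i : ℕ) + 1)) z =
      (powerNum z k).mulVec (fun i : Fin n => Y z ^ ((i : ℕ) + 1)) i / (eulerMatrix z).det := by
  have hroot := h.self_of_nhds
  have h0 : z 0 ≠ 0 := left_ne_zero_of_mul hz
  have hE : (eulerMatrix z).det ≠ 0 := right_ne_zero_of_mul hz
  have hL := eulerPoly_ne_zero hn hz hroot
  have h1 := mul_left_cancel₀ (pow_ne_zero n h0) (eulerPoly_mul_powerNum_mulVec hroot k i)
  have h2 := derivPoly_mul_partialDeriv hY h k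
  have h3 : partialDeriv k (fun w => Y w ^ ((i : ℕ) + 1)) z =
      ((i : ℕ) + 1) * Y z ^ (i : ℕ) * partialDeriv k Y z := by
    refine partialDeriv_eq_of_hasDerivAt (hY.pow _).differentiableAt ?_
    simpa using (hasDerivAt_partialDeriv hY.differentiableAt k).fun_pow ((i : ℕ) + 1)
  rw [h3, eq_div_iff hE]
  refine mul_left_cancel₀ hL ?_
  rw [h1, ← mul_derivPoly]
  linear_combination (Y z * ((i : ℕ) + 1) * Y z ^ (i : ℕ) * (eulerMatrix z).det) * h2

theorem partialDeriv_sysMatrix (hn : 1 ≤ n) {z : Coords n} (hz : poleFun z ≠ 0)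
    {Y : Coords n → Fin n → ℂ} (hY : IsRootGerm z Y) (k : Fin (n + 1)) (i j : SysIndex n) :
    partialDeriv k (fun w => sysMatrix (Y w) (poleRatio w) i j) z =
      ((Matrix.of fun i j => MvPolynomial.eval z (connectionNum ℂ n k i j) / poleFun z ^ 2) *
        sysMatrix (Y z) (poleRatio z)) i j := by
  -- The power block carries the factor t_0 G / G², which is 1 / det E because G = t_0 det E.
  have hM : (Matrix.of fun i j =>
      MvPolynomial.eval z (connectionNum ℂ n k i j) / poleFun z ^ 2) =
      Matrix.fromBlocks ((eulerMatrix z).det⁻¹ • powerNum z k) 0 0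
        (Matrix.fromBlocks 0 0
          (Matrix.of fun b _ => partialDeriv k (fun w => poleRatio w b) z) 0) := by
    ext i j
    rcases i with i | i | i <;> rcases j with j | j | j <;>
      simp only [connectionNum, Matrix.fromBlocks_apply₁₁, Matrix.fromBlocks_apply₁₂,
        Matrix.fromBlocks_apply₂₁, Matrix.fromBlocks_apply₂₂, Matrix.of_apply, Matrix.zero_apply,
        map_zero, zero_div, partialDeriv_poleRatio hz]
    have h := congrFun (congrFun (map_powerNum (MvPolynomial.eval z)
      (MvPolynomial.X : Fin (n + 1) → MvPolynomial (Fin (n + 1)) ℂ) k) i) j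
    have hX : (MvPolynomial.eval z) ∘ (MvPolynomial.X : Fin (n + 1) → _) = z := by
      funext i
      simp
    rw [RingHom.mapMatrix_apply, Matrix.map_apply, hX] at h
    simp only [Matrix.smul_apply, smul_eq_mul, map_mul, h, MvPolynomial.eval_X, eval_polePoly]
    have h0 : z 0 ≠ 0 := left_ne_zero_of_mul hz
    have hE : (eulerMatrix z).det ≠ 0 := right_ne_zero_of_mul hz
    rw [poleFun]
    field_simp
  rw [hM, sysMatrix, Matrix.fromBlocks_multiply, Matrix.fromBlocks_multiply]
  simp only [sysMatrix, Matrix.zero_mul, Matrix.mul_zero, add_zero, zero_add, Matrix.mul_one]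
  rcases i with i | i | i <;> rcases j with j | j | j <;>
    simp only [Matrix.fromBlocks_apply₁₁, Matrix.fromBlocks_apply₁₂,
        Matrix.fromBlocks_apply₂₁, Matrix.fromBlocks_apply₂₂, Matrix.of_apply, Matrix.zero_apply,
        partialDeriv_const]
  rw [partialDeriv_root_pow hn hz (hY.analyticAt j)
    (hY.isRootSystem.mono fun w hw => hw.isRoot j), Matrix.smul_mul, Matrix.smul_apply,
    smul_eq_mul, div_eq_inv_mul]
  rfl

theorem IsRootSystem.ne_zero (hn : 1 ≤ n) {w : Coords n} (hw : poleFun w ≠ 0) {y : Fin n → ℂ}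
    (h : IsRootSystem w y) (j : Fin n) : y j ≠ 0 := by
  have := eulerPoly_ne_zero hn hw (h.isRoot j)
  rw [← mul_derivPoly] at this
  exact left_ne_zero_of_mul this

theorem det_fundMatrix_ne_zero (hn : 1 ≤ n) {w : Coords n} (hw : poleFun w ≠ 0) {y : Fin n → ℂ}
    (h : IsRootSystem w y) : (fundMatrix w y).det ≠ 0 := by
  rw [fundMatrix, Matrix.det_submatrix_equiv_self, det_sysMatrix]
  refine mul_ne_zero (Finset.prod_ne_zero_iff.mpr fun j _ => h.ne_zero hn hw j) ?_
  refine Finset.prod_ne_zero_iff.mpr fun i _ => Finset.prod_ne_zero_iff.mpr fun j hj => ?_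
  exact sub_ne_zero.mpr fun hij => (Finset.mem_Ioi.mp hj).ne (h.injective hn hw hij).symm

theorem IsRootGerm.isFundamentalSolutionAt (hn : 1 ≤ n) {z : Coords n} (hz : poleFun z ≠ 0)
    {Y : Coords n → Fin n → ℂ} (hY : IsRootGerm z Y) :
    (algebraicSystem n).IsFundamentalSolutionAt z (fun w => fundMatrix w (Y w)) := by
  refine ⟨analyticAt_fundMatrix hz hY.analyticAt,
    det_fundMatrix_ne_zero hn hz hY.isRootSystem.self_of_nhds, ?_⟩
  filter_upwards [hY.eventually, eventually_poleFun_ne_zero hz] with w hw hpw k i j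
  rw [algebraicSystem_coeffAt hpw]
  have h := partialDeriv_sysMatrix hn hpw hw k ((sysEquiv n).symm i) ((sysEquiv n).symm j)
  exact h.trans (congrFun (congrFun (Matrix.submatrix_mul_equiv _ _ (sysEquiv n).symm
    (sysEquiv n).symm (sysEquiv n).symm).symm i) j)

end Local

/-! ### Analyticity of matrix operations -/

section Matrix

variable {E : Type*} [NormedAddCommGroup E] [NormedSpace ℂ E] {ι : Type*} [Fintype ι]

theorem analyticAt_matrix_mul {A B : E → Matrix ι ι ℂ} {z : E}
    (hA : ∀ i j, AnalyticAt ℂ (fun w => A w i j) z)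
    (hB : ∀ i j, AnalyticAt ℂ (fun w => B w i j) z) (i j : ι) :
    AnalyticAt ℂ (fun w => (A w * B w) i j) z := by
  simp only [Matrix.mul_apply]
  exact Finset.analyticAt_fun_sum _ fun k _ => (hA i k).mul (hB k j)

variable [DecidableEq ι]

theorem analyticAt_matrix_det {A : E → Matrix ι ι ℂ} {z : E}
    (hA : ∀ i j, AnalyticAt ℂ (fun w => A w i j) z) : AnalyticAt ℂ (fun w => (A w).det) z := by
  simp only [Matrix.det_apply]
  refine Finset.analyticAt_fun_sum _ fun s _ => ?_
  exact (Finset.analyticAt_fun_prod _ fun i _ => hA _ _).const_smul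

theorem analyticAt_matrix_inv {A : E → Matrix ι ι ℂ} {z : E}
    (hA : ∀ i j, AnalyticAt ℂ (fun w => A w i j) z) (hz : (A z).det ≠ 0) (i j : ι) :
    AnalyticAt ℂ (fun w => (A w)⁻¹ i j) z := by
  simp only [Matrix.inv_def, Matrix.smul_apply, smul_eq_mul, Ring.inverse_eq_inv']
  refine ((analyticAt_matrix_det hA).inv hz).mul ?_
  simp only [Matrix.adjugate_apply]
  refine analyticAt_matrix_det fun k l => ?_
  rcases eq_or_ne k j with rfl | hk
  · simp only [Matrix.updateRow_self]
    exact analyticAt_const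
  · simp only [Matrix.updateRow_ne hk]
    exact hA k l

end Matrix

/-! ### Partial derivatives -/

section Derivatives

variable {m d : ℕ}

theorem partialDeriv_congr {f g : Coords m → ℂ} {z : Coords m} (h : f =ᶠ[𝓝 z] g)
    (k : Fin (m + 1)) : partialDeriv k f z = partialDeriv k g z := by
  rw [partialDeriv, partialDeriv, h.fderiv_eq]

theorem partialDeriv_matrix_mul {A B : Coords m → Matrix (Fin d) (Fin d) ℂ} {z : Coords m}
    (hA : ∀ i j, DifferentiableAt ℂ (fun w => A w i j) z)
    (hB : ∀ i j, DifferentiableAt ℂ (fun w => B w i j) z) (k : Fin (m + 1)) (i j : Fin d) :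
    partialDeriv k (fun w => (A w * B w) i j) z =
      ((Matrix.of fun i j => partialDeriv k (fun w => A w i j) z) * B z +
        A z * Matrix.of fun i j => partialDeriv k (fun w => B w i j) z) i j := by
  simp only [Matrix.mul_apply, Matrix.add_apply, Matrix.of_apply]
  rw [partialDeriv, fderiv_fun_sum fun l _ => (hA i l).fun_mul (hB l j), ← Finset.sum_add_distrib,
    sum_apply]
  refine Finset.sum_congr rfl fun l _ => ?_
  rw [fderiv_fun_mul (hA i l) (hB l j)]
  simp only [add_apply, smul_apply, smul_eq_mul, partialDeriv]
  ring

theorem partialDeriv_comm {f : Coords m → ℂ} {z : Coords m} (hf : AnalyticAt ℂ f z)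
    (k l : Fin (m + 1)) :
    partialDeriv k (fun w => partialDeriv l f w) z =
      partialDeriv l (fun w => partialDeriv k f w) z := by
  have hsymm : IsSymmSndFDerivAt ℂ f z := hf.contDiffAt.isSymmSndFDerivAt (n := ⊤) (by simp)
  have hd : DifferentiableAt ℂ (fderiv ℂ f) z := hf.fderiv.differentiableAt
  have h : ∀ k l : Fin (m + 1), partialDeriv k (fun w => partialDeriv l f w) z =
      fderiv ℂ (fderiv ℂ f) z (Pi.single k 1) (Pi.single l 1) := by
    intro k l
    simp only [partialDeriv]
    rw [fderiv_clm_apply hd (differentiableAt_const _)]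
    simp
  rw [h, h, hsymm.eq]

theorem fderiv_eq_zero_of_partialDeriv {f : Coords m → ℂ} {z : Coords m}
    (h : ∀ k, partialDeriv k f z = 0) : fderiv ℂ f z = 0 := by
  refine ContinuousLinearMap.coe_injective (LinearMap.pi_ext' fun k => ?_)
  ext
  simpa [partialDeriv] using h k

end Derivatives

/-! ### Flatness, and uniqueness of solutions up to constants -/

namespace PfaffianForm

variable {m d : ℕ} {Ω : PfaffianForm m d}

/-- Since ∂_k ∂_l X = (∂_k Ω_l + Ω_l Ω_k) X is symmetric in k and l and X is invertible, the bracket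
is symmetric, and this is flatness. -/
theorem isFlat_of_exists_fundamentalSolution
    (hΩ : ∀ z ∈ Ω.regularSet, ∀ k i j, DifferentiableAt ℂ (fun w => Ω.coeffAt k w i j) z)
    (hX : ∀ z ∈ Ω.regularSet, ∃ X, Ω.IsFundamentalSolutionAt z X) : Ω.IsFlat := by
  intro z hz k l i j
  obtain ⟨X, hXa, hXd, hXe⟩ := hX z hz
  let D : Fin (m + 1) → Fin (m + 1) → Matrix (Fin d) (Fin d) ℂ := fun k l =>
    Matrix.of fun i j => partialDeriv k (fun w => Ω.coeffAt l w i j) z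
  have h1 : ∀ k l i j, partialDeriv k (fun w => partialDeriv l (fun v => X v i j) w) z =
      ((D k l + Ω.coeffAt l z * Ω.coeffAt k z) * X z) i j := by
    intro k l i j
    have : (fun w => partialDeriv l (fun v => X v i j) w) =ᶠ[𝓝 z]
        fun w => (Ω.coeffAt l w * X w) i j := hXe.mono fun w hw => hw l i j
    rw [partialDeriv_congr this, partialDeriv_matrix_mul (hΩ z hz l)
      (fun i j => (hXa i j).differentiableAt)]
    have h2 : (Matrix.of fun i j => partialDeriv k (fun w => X w i j) z) =
        Ω.coeffAt k z * X z := by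
      ext i j
      exact hXe.self_of_nhds k i j
    rw [h2, add_mul, mul_assoc]
  have h2 : (D k l + Ω.coeffAt l z * Ω.coeffAt k z) * X z =
      (D l k + Ω.coeffAt k z * Ω.coeffAt l z) * X z := by
    ext i j
    rw [← h1, ← h1, partialDeriv_comm (hXa i j)]
  have hu : IsUnit (X z) := (Matrix.isUnit_iff_isUnit_det _).mpr hXd.isUnit
  have h3 := congrFun (congrFun (hu.mul_right_cancel h2) i) j
  simp only [Matrix.add_apply, Matrix.sub_apply] at h3 ⊢
  change D k l i j - D l k i j = _
  linear_combination h3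

/-- Two fundamental solutions differ by a constant invertible matrix. -/
theorem IsFundamentalSolutionAt.exists_eq_mul {z : Coords m}
    {X X' : Coords m → Matrix (Fin d) (Fin d) ℂ} (hX : Ω.IsFundamentalSolutionAt z X)
    (hX' : Ω.IsFundamentalSolutionAt z X') :
    ∃ D : Matrix (Fin d) (Fin d) ℂ, D.det ≠ 0 ∧ X' =ᶠ[𝓝 z] fun w => X w * D := by
  obtain ⟨hXa, hXd, hXe⟩ := hX
  obtain ⟨hXa', hXd', hXe'⟩ := hX'
  let C : Coords m → Matrix (Fin d) (Fin d) ℂ := fun w => (X w)⁻¹ * X' w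
  have hCa : ∀ i j, AnalyticAt ℂ (fun w => C w i j) z :=
    analyticAt_matrix_mul (analyticAt_matrix_inv hXa hXd) hXa'
  have hdet : ∀ᶠ w in 𝓝 z, (X w).det ≠ 0 :=
    (analyticAt_matrix_det hXa).continuousAt.eventually_ne hXd
  have hXC : ∀ᶠ w in 𝓝 z, X w * C w = X' w := hdet.mono fun w hw => by
    rw [← mul_assoc, Matrix.mul_nonsing_inv _ hw.isUnit, one_mul]
  have hC0 : ∀ᶠ w in 𝓝 z, ∀ i j, fderiv ℂ (fun v => C v i j) w = 0 := by
    filter_upwards [hdet, hXC.eventually_nhds, hXe, hXe',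
      eventually_all.mpr fun i => eventually_all.mpr fun j => (hXa i j).eventually_analyticAt,
      eventually_all.mpr fun i => eventually_all.mpr fun j => (hCa i j).eventually_analyticAt]
      with w h1 h2 h3 h4 h5 h6 i j
    refine fderiv_eq_zero_of_partialDeriv fun k => ?_
    have h7 : (Matrix.of fun i j => partialDeriv k (fun v => X v i j) w) =
        Ω.coeffAt k w * X w := by
      ext i j
      exact h3 k i j
    -- Differentiating X C = X' gives Ω X C + X ∂C = Ω X', hence X ∂C = 0.
    have h8 : X w * (Matrix.of fun i j => partialDeriv k (fun v => C v i j) w) = X w * 0 := by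
      ext i j
      have h9 := partialDeriv_matrix_mul (fun i j => (h5 i j).differentiableAt)
        (fun i j => (h6 i j).differentiableAt) k i j
      have h10 : (fun v => (X v * C v) i j) =ᶠ[𝓝 w] fun v => X' v i j :=
        h2.mono fun v hv => by simp only [hv]
      rw [partialDeriv_congr h10, h4 k i j, h7, mul_assoc, h2.self_of_nhds, Matrix.add_apply]
        at h9
      simpa using h9
    have hu : IsUnit (X w) := (Matrix.isUnit_iff_isUnit_det _).mpr h1.isUnit
    exact congrFun (congrFun (hu.mul_left_cancel h8) i) j
  have hconst : ∀ᶠ w in 𝓝 z, C w = C z := by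
    obtain ⟨r, hr, hball⟩ := Metric.eventually_nhds_iff_ball.mp (hC0.and
      (eventually_all.mpr fun i => eventually_all.mpr fun j => (hCa i j).eventually_analyticAt))
    filter_upwards [Metric.ball_mem_nhds z hr] with w hw
    ext i j
    exact Metric.isOpen_ball.is_const_of_fderiv_eq_zero
      (convex_ball z r).isPreconnected
      (fun v hv => ((hball v hv).2 i j).differentiableAt.differentiableWithinAt)
      (fun v hv => (hball v hv).1 i j) hw (Metric.mem_ball_self hr)
  refine ⟨C z, ?_, ?_⟩
  · have := congrArg Matrix.det hXC.self_of_nhds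
    rw [Matrix.det_mul] at this
    exact right_ne_zero_of_mul (this ▸ hXd')
  · filter_upwards [hXC, hconst] with w h1 h2
    rw [← h2, h1]

end PfaffianForm

/-! ### Permanence of the description by roots under continuation -/

section Permanence

theorem iff_of_eventually_iff {α : Type*} [TopologicalSpace α] [PreconnectedSpace α]
    {P : α → Prop} (h : ∀ x, ∀ᶠ y in 𝓝 x, (P y ↔ P x)) (x y : α) : P x ↔ P y := by
  have : IsLocallyConstant P :=
    (IsLocallyConstant.iff_eventually_eq P).mpr fun x => (h x).mono fun y hy => propext hy
  exact iff_of_eq (this.apply_eq_of_preconnectedSpace x y)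

/-- Permanence of analytic relations. -/
theorem eventually_analytic_relation_iff {E A : Type*} [NormedAddCommGroup E] [NormedSpace ℂ E]
    {Φ : A → E → ℂ} {z : E} (h : ∀ᶠ w in 𝓝 z, ∀ a, AnalyticAt ℂ (Φ a) w) :
    ∀ᶠ w in 𝓝 z, ((∀ᶠ u in 𝓝 w, ∀ a, Φ a u = 0) ↔ ∀ᶠ u in 𝓝 z, ∀ a, Φ a u = 0) := by
  -- One ball serves all indices a at once, so the identity theorem applies to an infinite family of
  -- equations.
  obtain ⟨r, hr, hball⟩ := Metric.eventually_nhds_iff_ball.mp h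
  have key : ∀ w ∈ Metric.ball z r, (∀ᶠ u in 𝓝 w, ∀ a, Φ a u = 0) ↔
      ∀ u ∈ Metric.ball z r, ∀ a, Φ a u = 0 := by
    intro w hw
    constructor
    · intro h u hu a
      have hA : AnalyticOnNhd ℂ (Φ a) (Metric.ball z r) := fun v hv => hball v hv a
      exact hA.eqOn_zero_of_preconnected_of_eventuallyEq_zero
        (((convex_ball z r).isPreconnected)) hw (h.mono fun u hu => hu a) hu
    · intro h
      filter_upwards [Metric.isOpen_ball.mem_nhds hw] with u hu using h u hu
  filter_upwards [Metric.ball_mem_nhds z hr] with w hw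
  rw [key w hw, key z (Metric.mem_ball_self hr)]

variable {n : ℕ}

/-- `G` is the fundamental matrix of some analytic numbering of the roots near `z`. -/
def IsSolGerm (z : Coords n) (G : Coords n → Matrix (Fin (sysDim n)) (Fin (sysDim n)) ℂ) : Prop :=
  ∃ Y, IsRootGerm z Y ∧ G =ᶠ[𝓝 z] fun w => fundMatrix w (Y w)

theorem IsSolGerm.congr {z : Coords n}
    {G G' : Coords n → Matrix (Fin (sysDim n)) (Fin (sysDim n)) ℂ}
    (h : IsSolGerm z G) (hG : G' =ᶠ[𝓝 z] G) : IsSolGerm z G' := by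
  obtain ⟨Y, hY, h⟩ := h
  exact ⟨Y, hY, hG.trans h⟩

theorem isSolGerm_congr {z : Coords n}
    {G G' : Coords n → Matrix (Fin (sysDim n)) (Fin (sysDim n)) ℂ}
    (hG : G =ᶠ[𝓝 z] G') : IsSolGerm z G ↔ IsSolGerm z G' :=
  ⟨fun h => h.congr hG.symm, fun h => h.congr hG⟩

/-- The row of a matrix that contains the roots. -/
def rootRow (hn : 1 ≤ n) (M : Matrix (Fin (sysDim n)) (Fin (sysDim n)) ℂ) (j : Fin n) : ℂ :=
  M (sysEquiv n (Sum.inl ⟨0, hn⟩)) (sysEquiv n (Sum.inl j))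

theorem rootRow_fundMatrix (hn : 1 ≤ n) (w : Coords n) (y : Fin n → ℂ) :
    rootRow hn (fundMatrix w y) = y := by
  funext j
  simp [rootRow, fundMatrix, sysMatrix]

/-- The row of first powers recovers the numbering from the matrix, so the existential over
numberings becomes a system of equations on the entries of G. -/
theorem isSolGerm_iff (hn : 1 ≤ n) {z : Coords n}
    {G : Coords n → Matrix (Fin (sysDim n)) (Fin (sysDim n)) ℂ}
    (hG : ∀ i j, AnalyticAt ℂ (fun w => G w i j) z) :
    IsSolGerm z G ↔ ∀ᶠ w in 𝓝 z, IsRootSystem w (rootRow hn (G w)) ∧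
      G w = fundMatrix w (rootRow hn (G w)) := by
  constructor
  · rintro ⟨Y, hY, h⟩
    filter_upwards [hY.isRootSystem, h] with w h1 h2
    rw [h2, rootRow_fundMatrix]
    exact ⟨h1, rfl⟩
  · intro h
    exact ⟨fun w => rootRow hn (G w), ⟨fun j => hG _ _, h.mono fun w hw => hw.1⟩,
      h.mono fun w hw => hw.2⟩

theorem eventually_isSolGerm_iff (hn : 1 ≤ n) {z : Coords n} (hz : poleFun z ≠ 0)
    {G : Coords n → Matrix (Fin (sysDim n)) (Fin (sysDim n)) ℂ}
    (hG : ∀ i j, AnalyticAt ℂ (fun w => G w i j) z) :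
    ∀ᶠ w in 𝓝 z, (IsSolGerm w G ↔ IsSolGerm z G) := by
  -- The factorization of P is tested at each complex number T, giving one analytic equation per T;
  -- the other equations compare matrix entries.
  let Φ : ℂ ⊕ (Fin (sysDim n) × Fin (sysDim n)) → Coords n → ℂ := Sum.elim
    (fun T w => generalPoly w T - w 0 * ∏ j, (T - rootRow hn (G w) j))
    (fun p w => G w p.1 p.2 - fundMatrix w (rootRow hn (G w)) p.1 p.2)
  have hG' : ∀ᶠ w in 𝓝 z, ∀ i j, AnalyticAt ℂ (fun w => G w i j) w :=
    eventually_all.mpr fun i => eventually_all.mpr fun j => (hG i j).eventually_analyticAt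
  have hΦ : ∀ᶠ w in 𝓝 z, ∀ a, AnalyticAt ℂ (Φ a) w := by
    filter_upwards [hG', eventually_poleFun_ne_zero hz] with w h1 h2 a
    rcases a with T | ⟨i, j⟩
    · refine (analyticAt_generalPoly_comp analyticAt_id analyticAt_const).sub ?_
      have h0 : AnalyticAt ℂ (fun w : Coords n => w 0) w :=
        (ContinuousLinearMap.proj (R := ℂ) (φ := fun _ : Fin (n + 1) => ℂ) 0).analyticAt w
      exact h0.mul (Finset.analyticAt_fun_prod _ fun j _ => analyticAt_const.sub (h1 _ _))
    · exact (h1 i j).sub (analyticAt_fundMatrix h2 (fun j => h1 _ _) i j)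
  have key : ∀ w, (∀ i j, AnalyticAt ℂ (fun w => G w i j) w) →
      (IsSolGerm w G ↔ ∀ᶠ u in 𝓝 w, ∀ a, Φ a u = 0) := by
    intro w hw
    rw [isSolGerm_iff hn hw]
    refine eventually_congr (Eventually.of_forall fun u => ?_)
    constructor
    · rintro ⟨h1, h2⟩ (T | ⟨i, j⟩)
      · exact sub_eq_zero.mpr (h1 T)
      · exact sub_eq_zero.mpr (congrFun (congrFun h2 i) j)
    · intro h
      exact ⟨fun T => sub_eq_zero.mp (h (Sum.inl T)),
        Matrix.ext fun i j => sub_eq_zero.mp (h (Sum.inr (i, j)))⟩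
  filter_upwards [hG', eventually_analytic_relation_iff hΦ] with w h1 h2
  rw [key w h1, key z hG, h2]

theorem analyticAt_mul_const {E : Type*} [NormedAddCommGroup E] [NormedSpace ℂ E] {d : ℕ}
    {G : E → Matrix (Fin d) (Fin d) ℂ} {z : E}
    (hG : ∀ i j, AnalyticAt ℂ (fun w => G w i j) z) (D : Matrix (Fin d) (Fin d) ℂ) (i j : Fin d) :
    AnalyticAt ℂ (fun w => (G w * D) i j) z :=
  analyticAt_matrix_mul (B := fun _ => D) hG (fun _ _ => analyticAt_const) i j

/-- Along the path the property is locally constant, by permanence of the equations and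
compatibility of the germs, and the interval is connected. The constant factor D accommodates an
arbitrary fundamental solution. -/
theorem isSolGerm_of_isAnalyticContinuation (hn : 1 ≤ n) {γ : unitInterval → Coords n}
    (hγ : Continuous γ) (hp : ∀ s, poleFun (γ s) ≠ 0)
    {F : unitInterval → Coords n → Matrix (Fin (sysDim n)) (Fin (sysDim n)) ℂ}
    (hF : IsAnalyticContinuation γ F) {D : Matrix (Fin (sysDim n)) (Fin (sysDim n)) ℂ}
    (h0 : IsSolGerm (γ 0) fun w => F 0 w * D) (s : unitInterval) :
    IsSolGerm (γ s) fun w => F s w * D := by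
  refine (iff_of_eventually_iff (P := fun s => IsSolGerm (γ s) fun w => F s w * D)
    (fun s => ?_) 0 s).mp h0
  filter_upwards [hF.2 s, hγ.continuousAt.eventually (eventually_isSolGerm_iff hn (hp s)
    (analyticAt_mul_const (hF.1 s) D))] with s' h1 h2
  rw [← h2]
  exact isSolGerm_congr (h1.mono fun w hw => by simp only [hw])

theorem mul_one_submatrix {ι : Type*} [Fintype ι] [DecidableEq ι] (A : Matrix ι ι ℂ)
    (s : ι → ι) : A * (1 : Matrix ι ι ℂ).submatrix id s = A.submatrix id s := by
  ext i j
  simp [Matrix.mul_apply, Matrix.one_apply]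

theorem IsSolGerm.exists_perm (hn : 1 ≤ n) {z : Coords n} (hz : poleFun z ≠ 0)
    {G G' : Coords n → Matrix (Fin (sysDim n)) (Fin (sysDim n)) ℂ} (h : IsSolGerm z G)
    (h' : IsSolGerm z G') :
    ∃ s : Equiv.Perm (Fin (sysDim n)), G' z = G z * (1 : Matrix _ _ ℂ).submatrix id s := by
  obtain ⟨Y, hY, hG⟩ := h
  obtain ⟨Y', hY', hG'⟩ := h'
  obtain ⟨s, hs⟩ := hY.isRootSystem.self_of_nhds.exists_perm hn hz hY'.isRootSystem.self_of_nhds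
  refine ⟨(sysEquiv n).symm.trans ((Equiv.sumCongr s (Equiv.refl _)).trans (sysEquiv n)), ?_⟩
  rw [mul_one_submatrix, hG.self_of_nhds, hG'.self_of_nhds]
  simp only [hs, fundMatrix, sysMatrix_comp_perm]
  ext i j
  simp

theorem one_submatrix_pow {ι : Type*} [Fintype ι] [DecidableEq ι] (s : Equiv.Perm ι) (k : ℕ) :
    ((1 : Matrix ι ι ℂ).submatrix id s) ^ k = (1 : Matrix ι ι ℂ).submatrix id (s ^ k : Equiv.Perm ι)
    := by
  induction k with
  | zero => simp
  | succ k ih =>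
    rw [pow_succ, ih, mul_one_submatrix, Matrix.submatrix_submatrix, pow_succ]
    rfl

end Permanence

/-! ### Flatness and finite monodromy -/

section Quasiunipotent

variable {n : ℕ}

theorem exists_isSolGerm (hn : 1 ≤ n) {z : Coords n} (hz : poleFun z ≠ 0) :
    ∃ X, IsSolGerm z X ∧ (algebraicSystem n).IsFundamentalSolutionAt z X := by
  obtain ⟨y, hy⟩ := exists_isRootSystem (left_ne_zero_of_mul hz : z 0 ≠ 0)
  obtain ⟨Y, hY, -⟩ := exists_isRootGerm hn hz hy
  exact ⟨_, ⟨Y, hY, EventuallyEq.rfl⟩, hY.isFundamentalSolutionAt hn hz⟩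

theorem algebraicSystem_isFlat (hn : 1 ≤ n) (h0 : polePoly ℂ n ≠ 0) :
    (algebraicSystem n).IsFlat := by
  refine PfaffianForm.isFlat_of_exists_fundamentalSolution (fun z hz k i j => ?_) fun z hz => ?_
  · rw [mem_regularSet_iff hn h0] at hz
    have : (fun w => (algebraicSystem n).coeffAt k w i j) =ᶠ[𝓝 z] fun w =>
        MvPolynomial.eval w (connectionNum ℂ n k ((sysEquiv n).symm i) ((sysEquiv n).symm j))
          / poleFun w ^ 2 := by
      filter_upwards [eventually_poleFun_ne_zero hz] with w hw
      rw [algebraicSystem_coeffAt hw]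
      rfl
    exact (((analyticAt_eval _ z).fun_div ((analyticAt_poleFun z).fun_pow 2)
      (pow_ne_zero 2 hz)).congr this.symm).differentiableAt
  · obtain ⟨X, -, hX⟩ := exists_isSolGerm hn ((mem_regularSet_iff hn h0).mp hz)
    exact ⟨X, hX⟩

theorem algebraicSystem_isQuasiunipotent (hn : 1 ≤ n) (h0 : polePoly ℂ n ≠ 0) :
    (algebraicSystem n).IsQuasiunipotent := by
  intro h hh _ hreg
  obtain ⟨r₁, hr₁, h₁⟩ := Metric.eventually_nhds_iff_ball.mp hh.eventually_analyticAt
  obtain ⟨r₂, hr₂, h₂⟩ := Metric.eventually_nhds_iff_ball.mp (eventually_nhdsWithin_iff.mp hreg)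
  filter_upwards [Ioo_mem_nhdsGT (lt_min hr₁ hr₂)] with ε hε X F M hX hF hF0 hF1 μ hμ
  have hnorm : ∀ s, ‖circleLoop ε s‖ = ε := by
    intro s
    have : 2 * Real.pi * Complex.I * ((s : ℝ) : ℂ) = ((2 * Real.pi * s : ℝ) : ℂ) * Complex.I := by
      push_cast
      ring
    rw [circleLoop, this, norm_mul, Complex.norm_exp_ofReal_mul_I, mul_one, Complex.norm_real,
      Real.norm_of_nonneg hε.1.le]
  have hc0 : circleLoop ε 0 = ε := by simp [circleLoop]
  have hc1 : circleLoop ε 1 = ε := by simp [circleLoop, Complex.exp_two_pi_mul_I]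
  have hcont : Continuous (circleLoop ε) := by
    unfold circleLoop
    fun_prop
  have hp : ∀ s, poleFun (h (circleLoop ε s)) ≠ 0 := by
    intro s
    refine (mem_regularSet_iff hn h0).mp (h₂ _ ?_ ?_)
    · rw [mem_ball_zero_iff, hnorm]
      exact hε.2.trans_le (min_le_right _ _)
    · intro hs
      have := hnorm s
      rw [hs, norm_zero] at this
      exact hε.1.ne this
  have hγ : Continuous fun s => h (circleLoop ε s) := by
    refine continuous_iff_continuousAt.mpr fun s => ?_
    refine ContinuousAt.comp (g := h) (h₁ _ ?_).continuousAt hcont.continuousAt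
    rw [mem_ball_zero_iff, hnorm]
    exact hε.2.trans_le (min_le_left _ _)
  have hpε : poleFun (h ε) ≠ 0 := hc0 ▸ hp 0
  obtain ⟨X₀, hX₀, hX₀'⟩ := exists_isSolGerm hn hpε
  obtain ⟨D, hD, hXD⟩ := hX.exists_eq_mul hX₀'
  have hs0 : IsSolGerm (h (circleLoop ε 0)) fun w => F 0 w * D := by
    rw [hc0]
    refine hX₀.congr ?_
    filter_upwards [hF0, hXD] with w h1 h2
    rw [h1, h2]
  have hs1 := isSolGerm_of_isAnalyticContinuation hn hγ hp hF hs0 1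
  rw [hc1] at hs1
  obtain ⟨σ, hσ⟩ := hX₀.exists_perm hn hpε hs1
  simp only [hF1.self_of_nhds, hXD.self_of_nhds, mul_assoc] at hσ
  have hu : IsUnit (X (h ε)) := (Matrix.isUnit_iff_isUnit_det _).mpr hX.2.1.isUnit
  -- With P the permutation matrix of σ, X M D = X D P at the base point; hence M = D P D⁻¹ has
  -- finite order.
  have hMD := hu.mul_left_cancel hσ
  have hDu : IsUnit D.det := hD.isUnit
  have hMk : ∀ k, M ^ k * D = D * ((1 : Matrix _ _ ℂ).submatrix id σ) ^ k := by
    intro k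
    induction k with
    | zero => simp
    | succ k ih => rw [pow_succ, mul_assoc, hMD, ← mul_assoc, ih, mul_assoc, ← pow_succ]
  have hM1 : M ^ Fintype.card (Equiv.Perm (Fin (sysDim n))) = 1 := by
    have h1 := hMk (Fintype.card (Equiv.Perm (Fin (sysDim n))))
    rw [one_submatrix_pow, pow_card_eq_one] at h1
    have h2 : (1 : Matrix (Fin (sysDim n)) (Fin (sysDim n)) ℂ).submatrix id
        (1 : Equiv.Perm (Fin (sysDim n))) = 1 := by
      rw [Equiv.Perm.coe_one, Matrix.submatrix_id_id]
    rw [h2, mul_one] at h1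
    have hDu' : IsUnit D := (Matrix.isUnit_iff_isUnit_det _).mpr hDu
    exact hDu'.mul_right_cancel (h1.trans (one_mul D).symm)
  refine ⟨Fintype.card (Equiv.Perm (Fin (sysDim n))), Fintype.card_pos, ?_⟩
  -- The spectrum of the identity is {1} only in a nontrivial matrix ring, so the dimension has to
  -- be positive.
  have hne : Nonempty (Fin (sysDim n)) := ⟨sysEquiv n (Sum.inl ⟨0, hn⟩)⟩
  have := spectrum.pow_mem_pow M (Fintype.card (Equiv.Perm (Fin (sysDim n)))) hμ
  rw [hM1, spectrum.one_eq] at this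
  exact this

end Quasiunipotent

/-! ### A Łojasiewicz inequality for homogeneous polynomials -/

section DistanceEstimate

variable {m : ℕ}

theorem natDegree_coeff_prod {ι : Type*} (s : Finset ι) (f : ι → Polynomial ℂ) (d : ι → ℕ)
    (h : ∀ i ∈ s, (f i).natDegree ≤ d i) :
    (∏ i ∈ s, f i).natDegree ≤ ∑ i ∈ s, d i ∧
      (∏ i ∈ s, f i).coeff (∑ i ∈ s, d i) = ∏ i ∈ s, (f i).coeff (d i) := by
  classical
  induction s using Finset.induction_on with
  | empty => simp
  | insert a s ha ih =>
    obtain ⟨h1, h2⟩ := ih fun i hi => h i (Finset.mem_insert_of_mem hi)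
    have h3 := h a (Finset.mem_insert_self a s)
    rw [Finset.prod_insert ha, Finset.sum_insert ha, Finset.prod_insert ha,
      Polynomial.coeff_mul_add_eq_of_natDegree_le h3 h1, h2]
    exact ⟨Polynomial.natDegree_mul_le.trans (add_le_add h3 h1), rfl⟩

/-- The restriction of a polynomial to the line through `z` with direction `v`. -/
def lineRestrict (p : MvPolynomial (Fin (m + 1)) ℂ) (z v : Coords m) : Polynomial ℂ :=
  MvPolynomial.eval₂ Polynomial.C
    (fun i => Polynomial.C (v i) * Polynomial.X + Polynomial.C (z i)) p

theorem eval_lineRestrict (p : MvPolynomial (Fin (m + 1)) ℂ) (z v : Coords m) (c : ℂ) :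
    (lineRestrict p z v).eval c = MvPolynomial.eval (z + c • v) p := by
  rw [lineRestrict, ← Polynomial.coe_evalRingHom, MvPolynomial.hom_eval₂]
  have h1 : (Polynomial.evalRingHom c).comp Polynomial.C = RingHom.id ℂ := by
    ext
    simp
  rw [h1, MvPolynomial.eval]
  congr 1
  funext i
  simp
  ring

theorem natDegree_coeff_lineRestrict {p : MvPolynomial (Fin (m + 1)) ℂ} {e : ℕ}
    (hp : p.IsHomogeneous e) (z v : Coords m) :
    (lineRestrict p z v).natDegree ≤ e ∧
      (lineRestrict p z v).coeff e = MvPolynomial.eval v p := by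
  have hlin : ∀ i, (Polynomial.C (v i) * Polynomial.X + Polynomial.C (z i)).natDegree ≤ 1 :=
    fun i => Polynomial.natDegree_linear_le
  have h : ∀ s ∈ p.support,
      (∏ i ∈ s.support, (Polynomial.C (v i) * Polynomial.X + Polynomial.C (z i)) ^ s i).natDegree
        ≤ e ∧
      (∏ i ∈ s.support, (Polynomial.C (v i) * Polynomial.X + Polynomial.C (z i)) ^ s i).coeff e =
        ∏ i ∈ s.support, v i ^ s i := by
    intro s hs
    have h1 := natDegree_coeff_prod s.support
      (fun i => (Polynomial.C (v i) * Polynomial.X + Polynomial.C (z i)) ^ s i) s fun i _ =>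
        (Polynomial.natDegree_pow_le_of_le (s i) (hlin i)).trans (mul_one (s i)).le
    rw [← hp.degree_eq_sum_deg_support hs] at h1
    refine ⟨h1.1, h1.2.trans (Finset.prod_congr rfl fun i _ => ?_)⟩
    have := Polynomial.coeff_pow_of_natDegree_le (m := s i) (hlin i)
    rw [mul_one] at this
    rw [this]
    simp
  rw [lineRestrict, MvPolynomial.eval₂_eq]
  constructor
  · exact Polynomial.natDegree_sum_le_of_forall_le _ _ fun s hs =>
      (Polynomial.natDegree_C_mul_le _ _).trans (h s hs).1
  · rw [Polynomial.finsetSum_coeff, MvPolynomial.eval_eq]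
    exact Finset.sum_congr rfl fun s hs => by rw [Polynomial.coeff_C_mul, (h s hs).2]

/-- The Hermitian space of homogeneous coordinate vectors. -/
abbrev hermitian (z : Coords m) : EuclideanSpace ℂ (Fin (m + 1)) := WithLp.toLp 2 z

/-- Scaling a point of S brings it arbitrarily close to the origin; for empty S, `Metric.infDist` is
0. This replaces the origin, which S itself need not contain, as a point at distance zero from S. -/
theorem infDist_le_norm {S : Set (Coords m)} (hS : ∀ w ∈ S, ∀ t : ℝ, 0 < t → (t : ℂ) • w ∈ S)
    (z : Coords m) : Metric.infDist (hermitian z) (hermitian '' S) ≤ ‖hermitian z‖ := by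
  rcases S.eq_empty_or_nonempty with rfl | ⟨w, hw⟩
  · simp
  · refine le_of_forall_pos_le_add fun ε hε => ?_
    have hw1 : 0 < ‖hermitian w‖ + 1 := by positivity
    have ht : 0 < ε / (‖hermitian w‖ + 1) := by positivity
    refine (Metric.infDist_le_dist_of_mem (Set.mem_image_of_mem _ (hS w hw _ ht))).trans ?_
    rw [dist_eq_norm]
    refine (norm_sub_le _ _).trans (add_le_add le_rfl ?_)
    have : hermitian (((ε / (‖hermitian w‖ + 1) : ℝ) : ℂ) • w) =
        ((ε / (‖hermitian w‖ + 1) : ℝ) : ℂ) • hermitian w := rfl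
    rw [this, norm_smul, Complex.norm_real, Real.norm_of_nonneg ht.le, div_mul_eq_mul_div,
      div_le_iff₀ hw1]
    nlinarith

/-- An elementary Łojasiewicz inequality for a homogeneous polynomial. -/
theorem infDist_pow_le {p : MvPolynomial (Fin (m + 1)) ℂ} {e : ℕ} (hp : p.IsHomogeneous e)
    {S : Set (Coords m)} (hS : ∀ w, w ∈ S ↔ w ≠ 0 ∧ MvPolynomial.eval w p = 0) {v : Coords m}
    (hv : MvPolynomial.eval v p ≠ 0) (z : Coords m) :
    ‖MvPolynomial.eval v p‖ * Metric.infDist (hermitian z) (hermitian '' S) ^ e ≤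
      ‖MvPolynomial.eval z p‖ * ‖hermitian v‖ ^ e := by
  obtain ⟨hd, hc⟩ := natDegree_coeff_lineRestrict hp z v
  have hne : (lineRestrict p z v).coeff e ≠ 0 := by rwa [hc]
  have hdeg : (lineRestrict p z v).natDegree = e :=
    hd.antisymm (Polynomial.le_natDegree_of_ne_zero hne)
  have hq0 : lineRestrict p z v ≠ 0 := fun h => hne (by rw [h, Polynomial.coeff_zero])
  have hs := IsAlgClosed.splits (lineRestrict p z v)
  have hscale : ∀ w ∈ S, ∀ t : ℝ, 0 < t → (t : ℂ) • w ∈ S := by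
    intro w hw t ht
    have ht' : (t : ℂ) ≠ 0 := by exact_mod_cast ht.ne'
    rw [hS] at hw ⊢
    refine ⟨smul_ne_zero ht' hw.1, ?_⟩
    have h2 := eval_lineRestrict p 0 w t
    have h3 : lineRestrict p 0 w = Polynomial.C (MvPolynomial.eval w p) * Polynomial.X ^ e := by
      rw [lineRestrict, MvPolynomial.eval₂_eq, MvPolynomial.eval_eq, map_sum, Finset.sum_mul]
      refine Finset.sum_congr rfl fun s hs => ?_
      simp only [Pi.zero_apply, map_zero, add_zero, mul_pow, Finset.prod_mul_distrib,
        Finset.prod_pow_eq_pow_sum, ← hp.degree_eq_sum_deg_support hs, map_mul, map_prod, map_pow]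
      ring
    rw [zero_add, h3, hw.2] at h2
    simpa using h2.symm
  -- Each root c gives a zero z + c v of p at distance |c| |v| from z. If this zero is the origin,
  -- the distance to S is bounded by |z| instead.
  have hroot : ∀ c ∈ (lineRestrict p z v).roots,
      Metric.infDist (hermitian z) (hermitian '' S) ≤ ‖c‖ * ‖hermitian v‖ := by
    intro c hcr
    have hev : MvPolynomial.eval (z + c • v) p = 0 := by
      rw [← eval_lineRestrict]
      exact (Polynomial.mem_roots hq0).mp hcr
    have hdist : ‖hermitian z - hermitian (z + c • v)‖ = ‖c‖ * ‖hermitian v‖ := by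
      have : hermitian z - hermitian (z + c • v) = -(c • hermitian v) := by
        ext i
        simp
      rw [this, norm_neg, norm_smul]
    by_cases h0 : z + c • v = 0
    · refine (infDist_le_norm hscale z).trans ?_
      rw [← hdist, h0]
      simp
    · rw [← hdist, ← dist_eq_norm]
      exact Metric.infDist_le_dist_of_mem (Set.mem_image_of_mem _ ((hS _).mpr ⟨h0, hev⟩))
  -- The restriction to the line has degree e and leading coefficient p(v); its value at 0 is p(z),
  -- so |p(z)| is |p(v)| times the product of the |c|.
  have hprod : MvPolynomial.eval z p =
      MvPolynomial.eval v p * ((lineRestrict p z v).roots.map fun c => -c).prod := by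
    have h1 : (lineRestrict p z v).eval 0 = MvPolynomial.eval z p := by
      rw [eval_lineRestrict]
      simp
    rw [← h1]
    conv_lhs => rw [hs.eq_prod_roots]
    rw [Polynomial.eval_mul, Polynomial.eval_C, Polynomial.leadingCoeff, hdeg, hc,
      Polynomial.eval_multiset_prod, Multiset.map_map]
    simp
  have hbound : ∀ R : Multiset ℂ,
      (∀ c ∈ R, Metric.infDist (hermitian z) (hermitian '' S) ≤ ‖c‖ * ‖hermitian v‖) →
      Metric.infDist (hermitian z) (hermitian '' S) ^ Multiset.card R ≤
        ‖(R.map fun c => -c).prod‖ * ‖hermitian v‖ ^ Multiset.card R := by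
    intro R
    induction R using Multiset.induction_on with
    | empty => simp
    | cons a R ih =>
      intro h
      rw [Multiset.card_cons, Multiset.map_cons, Multiset.prod_cons, pow_succ, pow_succ, norm_mul,
        norm_neg]
      calc _ ≤ (‖(R.map fun c => -c).prod‖ * ‖hermitian v‖ ^ Multiset.card R) *
            (‖a‖ * ‖hermitian v‖) :=
            mul_le_mul (ih fun c hc => h c (Multiset.mem_cons_of_mem hc))
              (h a (Multiset.mem_cons_self a R)) Metric.infDist_nonneg (by positivity)
        _ = _ := by ring
  have hcard : Multiset.card (lineRestrict p z v).roots = e := by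
    rw [← hdeg]
    exact hs.natDegree_eq_card_roots.symm
  have h1 := hbound _ hroot
  rw [hcard] at h1
  rw [hprod, norm_mul, mul_assoc]
  exact mul_le_mul_of_nonneg_left h1 (norm_nonneg _)

end DistanceEstimate

/-! ### The algebra of functions of moderate growth -/

section ModerateGrowth

variable (n : ℕ)

/-- Normalized coordinate vectors outside the polar locus with a numbering of the roots. -/
abbrev NormalizedPoint : Type :=
  {p : Coords n × (Fin n → ℂ) // (∀ i, ‖p.1 i‖ ≤ 1) ∧ poleFun p.1 ≠ 0 ∧ IsRootSystem p.1 p.2}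

variable {n}

/-- The growth scale at a point. -/
def growthScale (p : NormalizedPoint n) : ℝ := 1 + ‖poleFun p.1.1‖⁻¹

theorem one_le_growthScale (p : NormalizedPoint n) : 1 ≤ growthScale p :=
  le_add_of_nonneg_right (inv_nonneg.mpr (norm_nonneg _))

/-- The function is bounded by a power of the growth scale. -/
def HasModerateGrowth (f : NormalizedPoint n → ℂ) : Prop :=
  ∃ C : ℝ, ∃ N : ℕ, 0 ≤ C ∧ ∀ p, ‖f p‖ ≤ C * growthScale p ^ N

theorem HasModerateGrowth.of_le {f : NormalizedPoint n → ℂ} (C : ℝ) (N : ℕ)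
    (h : ∀ p, ‖f p‖ ≤ C * growthScale p ^ N) : HasModerateGrowth f := by
  refine ⟨|C|, N, abs_nonneg C, fun p => (h p).trans ?_⟩
  have := one_le_growthScale p
  gcongr
  exact le_abs_self C

theorem HasModerateGrowth.add {f g : NormalizedPoint n → ℂ} (hf : HasModerateGrowth f)
    (hg : HasModerateGrowth g) : HasModerateGrowth (f + g) := by
  obtain ⟨C, N, hC, hf⟩ := hf
  obtain ⟨C', N', hC', hg⟩ := hg
  refine ⟨C + C', N + N', add_nonneg hC hC', fun p => (norm_add_le _ _).trans ?_⟩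
  rw [add_mul]
  have := one_le_growthScale p
  refine add_le_add ((hf p).trans ?_) ((hg p).trans ?_)
  · gcongr
    · exact Nat.le_add_right _ _
  · gcongr
    · exact Nat.le_add_left _ _

theorem HasModerateGrowth.mul {f g : NormalizedPoint n → ℂ} (hf : HasModerateGrowth f)
    (hg : HasModerateGrowth g) : HasModerateGrowth (f * g) := by
  obtain ⟨C, N, hC, hf⟩ := hf
  obtain ⟨C', N', hC', hg⟩ := hg
  refine ⟨C * C', N + N', mul_nonneg hC hC', fun p => ?_⟩
  have h1 := one_le_growthScale p
  rw [Pi.mul_apply, norm_mul, pow_add, mul_mul_mul_comm]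
  exact mul_le_mul (hf p) (hg p) (norm_nonneg _) (by positivity)

variable (n) in
/-- The algebra of functions of moderate growth. -/
def moderateGrowth : Subalgebra ℂ (NormalizedPoint n → ℂ) where
  carrier := {f | HasModerateGrowth f}
  mul_mem' := HasModerateGrowth.mul
  add_mem' := HasModerateGrowth.add
  algebraMap_mem' c := HasModerateGrowth.of_le ‖c‖ 0 fun p => by simp

theorem HasModerateGrowth.exists_uniform {ι : Type*} [Finite ι] {f : ι → NormalizedPoint n → ℂ}
    (hf : ∀ i, HasModerateGrowth (f i)) :
    ∃ C : ℝ, ∃ N : ℕ, 0 ≤ C ∧ ∀ i p, ‖f i p‖ ≤ C * growthScale p ^ N := by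
  have := Fintype.ofFinite ι
  choose C N hC h using hf
  refine ⟨∑ i, C i, ∑ i, N i, Finset.sum_nonneg fun i _ => hC i, fun i p => (h i p).trans ?_⟩
  have h1 := one_le_growthScale p
  gcongr
  · exact Finset.sum_nonneg fun i _ => hC i
  · exact Finset.single_le_sum (fun i _ => hC i) (Finset.mem_univ i)
  · exact Finset.single_le_sum (fun i _ => Nat.zero_le _) (Finset.mem_univ i)

/-- Evaluation of a function of moderate growth. -/
def evalGrowth (p : NormalizedPoint n) : moderateGrowth n →+* ℂ :=
  (Pi.evalRingHom (fun _ : NormalizedPoint n => ℂ) p).comp (moderateGrowth n).subtype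

theorem evalGrowth_ext {f g : moderateGrowth n} (h : ∀ p, evalGrowth p f = evalGrowth p g) :
    f = g :=
  Subtype.ext (funext h)

/-- The coordinates. -/
def coordGrowth (i : Fin (n + 1)) : moderateGrowth n :=
  ⟨fun p => p.1.1 i, HasModerateGrowth.of_le 1 0 fun p => by simpa using p.2.1 i⟩

/-- The inverse of the polynomial that defines the polar locus. -/
def poleInvGrowth : moderateGrowth n :=
  ⟨fun p => (poleFun p.1.1)⁻¹, HasModerateGrowth.of_le 1 1 fun p => by
    rw [norm_inv, pow_one, one_mul, growthScale]
    linarith⟩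

theorem evalGrowth_poleFun (p : NormalizedPoint n) :
    evalGrowth p (poleFun coordGrowth) = poleFun p.1.1 := by
  rw [map_poleFun]
  rfl

theorem poleFun_mul_poleInvGrowth : poleFun (coordGrowth (n := n)) * poleInvGrowth = 1 := by
  refine evalGrowth_ext fun p => ?_
  rw [map_mul, evalGrowth_poleFun, map_one]
  exact mul_inv_cancel₀ p.2.2.1

/-- Factors of a unit are units. From G this gives moderate growth of the inverses of t_0, det E, y
P'(y), and then of every root and every difference of two roots. -/
theorem isUnit_poleFun_coordGrowth : IsUnit (poleFun (coordGrowth (n := n))) :=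
  IsUnit.of_mul_eq_one _ poleFun_mul_poleInvGrowth

/-- Cauchy's bound: if |y| > 1, then P(y) = 0 gives |t_0| |y|^n ≤ n |y|^{n-1}. -/
theorem norm_root_le (hn : 1 ≤ n) {w : Coords n} (h0 : w 0 ≠ 0) (hw : ∀ i, ‖w i‖ ≤ 1) {y : ℂ}
    (hy : generalPoly w y = 0) : ‖y‖ ≤ 1 + n * ‖(w 0)⁻¹‖ := by
  by_cases h1 : ‖y‖ ≤ 1
  · exact h1.trans (le_add_of_nonneg_right (by positivity))
  · have h1 : 1 < ‖y‖ := not_le.mp h1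
    rw [generalPoly, Fin.sum_univ_succ, Fin.val_zero, Nat.sub_zero, add_eq_zero_iff_eq_neg] at hy
    have h2 : ‖w 0‖ * ‖y‖ ^ n ≤ n * ‖y‖ ^ (n - 1) := by
      rw [← norm_pow, ← norm_mul, hy, norm_neg]
      refine (norm_sum_le_of_le _ (f := fun i : Fin n => w i.succ * y ^ (n - (i.succ : ℕ)))
        (n := fun _ => ‖y‖ ^ (n - 1)) fun i _ => ?_).trans ?_
      · rw [norm_mul, norm_pow, ← one_mul (‖y‖ ^ (n - 1))]
        refine mul_le_mul (hw _) (pow_le_pow_right₀ h1.le ?_) (by positivity) zero_le_one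
        simp only [Fin.val_succ]
        omega
      · simp
    have hyn : ‖y‖ ^ n = ‖y‖ * ‖y‖ ^ (n - 1) := by
      rw [← pow_succ']
      congr 1
      omega
    rw [hyn, ← mul_assoc] at h2
    have h3 := le_of_mul_le_mul_right h2 (by positivity)
    have hw0 : 0 < ‖w 0‖ := norm_pos_iff.mpr h0
    rw [norm_inv]
    refine le_add_of_nonneg_of_le zero_le_one ?_
    rw [← div_eq_mul_inv, le_div_iff₀ hw0, mul_comm]
    exact h3

theorem isUnit_coordGrowth_zero : IsUnit (coordGrowth (n := n) 0) :=
  isUnit_of_mul_isUnit_left isUnit_poleFun_coordGrowth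

theorem rootGrowth_mem (hn : 1 ≤ n) (j : Fin n) :
    (fun p : NormalizedPoint n => p.1.2 j) ∈ moderateGrowth n := by
  obtain ⟨u, hu⟩ := isUnit_coordGrowth_zero (n := n)
  have h1 : ∀ p : NormalizedPoint n, evalGrowth p (↑u⁻¹ : moderateGrowth n) = (p.1.1 0)⁻¹ := by
    intro p
    refine eq_inv_of_mul_eq_one_right ?_
    have := congrArg (evalGrowth p) u.mul_inv
    rw [map_mul, hu, map_one] at this
    exact this
  obtain ⟨C, N, hC, h2⟩ := (↑u⁻¹ : moderateGrowth n).2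
  refine HasModerateGrowth.of_le (1 + n * C) N fun p => ?_
  refine (norm_root_le hn (left_ne_zero_of_mul p.2.2.1) p.2.1 (p.2.2.2.isRoot j)).trans ?_
  rw [add_mul, mul_assoc, one_mul, ← h1 p]
  exact add_le_add (one_le_pow₀ (one_le_growthScale p))
    (mul_le_mul_of_nonneg_left (h2 p) (Nat.cast_nonneg n))

/-- The roots. -/
def rootGrowth (hn : 1 ≤ n) (j : Fin n) : moderateGrowth n := ⟨_, rootGrowth_mem hn j⟩

theorem isUnit_eulerPoly_rootGrowth (hn : 1 ≤ n) (j : Fin n) :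
    IsUnit (eulerPoly coordGrowth (rootGrowth hn j)) := by
  have hroot : generalPoly coordGrowth (rootGrowth hn j) = 0 := by
    refine evalGrowth_ext fun p => ?_
    rw [map_generalPoly, map_zero]
    exact p.2.2.2.isRoot j
  have h1 := congrFun (adjugate_eulerMatrix_mulVec hroot) ⟨0, hn⟩
  simp only [Pi.smul_apply, smul_eq_mul, pow_zero, mul_one] at h1
  have h2 : IsUnit (eulerMatrix (coordGrowth (n := n))).det :=
    isUnit_of_mul_isUnit_right isUnit_poleFun_coordGrowth
  rw [← h1] at h2
  exact isUnit_of_mul_isUnit_right (isUnit_of_mul_isUnit_left h2)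

theorem eulerPoly_rootGrowth (hn : 1 ≤ n) (j : Fin n) :
    eulerPoly coordGrowth (rootGrowth hn j) = rootGrowth hn j * (coordGrowth 0 *
      ∏ i ∈ Finset.univ.erase j, (rootGrowth hn j - rootGrowth hn i)) := by
  refine evalGrowth_ext fun p => ?_
  rw [map_eulerPoly, map_mul, map_mul, map_prod]
  simp only [map_sub]
  exact (mul_derivPoly _ _).symm.trans (congrArg _ (p.2.2.2.derivPoly_eq j))

theorem isUnit_rootGrowth (hn : 1 ≤ n) (j : Fin n) : IsUnit (rootGrowth hn j) := by
  have := isUnit_eulerPoly_rootGrowth hn j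
  rw [eulerPoly_rootGrowth] at this
  exact isUnit_of_mul_isUnit_left this

theorem isUnit_rootGrowth_sub (hn : 1 ≤ n) {i j : Fin n} (hij : i ≠ j) :
    IsUnit (rootGrowth hn j - rootGrowth hn i) := by
  have := isUnit_eulerPoly_rootGrowth hn j
  rw [eulerPoly_rootGrowth] at this
  refine isUnit_of_dvd_unit ?_ (isUnit_of_mul_isUnit_right (isUnit_of_mul_isUnit_right this))
  exact Finset.dvd_prod_of_mem _ (Finset.mem_erase.mpr ⟨hij, Finset.mem_univ i⟩)

/-- The rational functions with poles along the polar locus. -/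
def ratioGrowth (b : Fin (n + 1) × Fin (n + 1)) : moderateGrowth n :=
  coordGrowth b.1 ^ (n * (n + 1)) * coordGrowth b.2 * poleInvGrowth

theorem evalGrowth_sysMatrix (hn : 1 ≤ n) (p : NormalizedPoint n) :
    (evalGrowth p).mapMatrix (sysMatrix (rootGrowth hn) ratioGrowth) =
      sysMatrix p.1.2 (poleRatio p.1.1) := by
  rw [map_sysMatrix]
  congr 1
  funext b
  rw [poleRatio, div_eq_mul_inv, poleMonomial]
  simp only [Function.comp_apply, ratioGrowth, map_mul, map_pow, MvPolynomial.eval_X]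
  rfl

theorem isUnit_det_sysMatrix_growth (hn : 1 ≤ n) :
    IsUnit (sysMatrix (rootGrowth hn) (ratioGrowth (n := n))).det := by
  rw [det_sysMatrix, IsUnit.mul_iff]
  constructor
  · exact Finset.prod_induction _ IsUnit (fun _ _ => IsUnit.mul) isUnit_one
      fun j _ => isUnit_rootGrowth hn j
  · refine Finset.prod_induction _ IsUnit (fun _ _ => IsUnit.mul) isUnit_one fun i _ => ?_
    refine Finset.prod_induction _ IsUnit (fun _ _ => IsUnit.mul) isUnit_one fun j hj => ?_
    exact isUnit_rootGrowth_sub hn (Finset.mem_Ioi.mp hj).ne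

/-- The fundamental matrix is invertible over the algebra of functions of moderate growth, so the
bound on its inverse needs no separate estimate. -/
theorem exists_growth_bound_sysMatrix (hn : 1 ≤ n) :
    ∃ C : ℝ, ∃ N : ℕ, 0 ≤ C ∧ ∀ (i j : SysIndex n) (p : NormalizedPoint n),
      ‖sysMatrix p.1.2 (poleRatio p.1.1) i j‖ ≤ C * growthScale p ^ N ∧
        ‖(sysMatrix p.1.2 (poleRatio p.1.1))⁻¹ i j‖ ≤ C * growthScale p ^ N := by
  set A := sysMatrix (rootGrowth hn) (ratioGrowth (n := n)) with hA
  have hinv : ∀ p : NormalizedPoint n, (sysMatrix p.1.2 (poleRatio p.1.1))⁻¹ =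
      (evalGrowth p).mapMatrix A⁻¹ := by
    intro p
    refine Matrix.inv_eq_right_inv ?_
    rw [← evalGrowth_sysMatrix hn, ← map_mul,
      Matrix.mul_nonsing_inv _ (isUnit_det_sysMatrix_growth hn), map_one]
  obtain ⟨C, N, hC, h⟩ := HasModerateGrowth.exists_uniform
    (ι := Bool × SysIndex n × SysIndex n)
    (f := fun x => (if x.1 then A x.2.1 x.2.2 else A⁻¹ x.2.1 x.2.2 : moderateGrowth n).1)
    fun x => (if x.1 then A x.2.1 x.2.2 else A⁻¹ x.2.1 x.2.2 : moderateGrowth n).2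
  refine ⟨C, N, hC, fun i j p => ⟨?_, ?_⟩⟩
  · rw [← evalGrowth_sysMatrix hn]
    exact h (true, i, j) p
  · rw [hinv]
    exact h (false, i, j) p

end ModerateGrowth

/-! ### From normalized vectors to projective distance -/

section Normalization

variable {n : ℕ}

theorem generalPoly_smul (c : ℂ) (w : Coords n) (y : ℂ) :
    generalPoly (c • w) y = c * generalPoly w y := by
  simp [generalPoly, Finset.mul_sum, mul_assoc]

theorem IsRootSystem.smul {w : Coords n} {y : Fin n → ℂ} (h : IsRootSystem w y) (c : ℂ) :
    IsRootSystem (c • w) y := by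
  intro T
  rw [generalPoly_smul, h T, Pi.smul_apply, smul_eq_mul, mul_assoc]

theorem eval_smul_of_isHomogeneous {p : MvPolynomial (Fin (n + 1)) ℂ} {e : ℕ}
    (hp : p.IsHomogeneous e) (c : ℂ) (w : Coords n) :
    MvPolynomial.eval (c • w) p = c ^ e * MvPolynomial.eval w p := by
  rw [MvPolynomial.eval_eq, MvPolynomial.eval_eq, Finset.mul_sum]
  refine Finset.sum_congr rfl fun s hs => ?_
  simp only [Pi.smul_apply, smul_eq_mul, mul_pow, Finset.prod_mul_distrib,
    Finset.prod_pow_eq_pow_sum, ← hp.degree_eq_sum_deg_support hs]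
  ring

theorem poleFun_smul (c : ℂ) (w : Coords n) :
    poleFun (c • w) = c ^ (n * (n + 1) + 1) * poleFun w := by
  rw [← eval_polePoly, ← eval_polePoly, eval_smul_of_isHomogeneous (polePoly_isHomogeneous ℂ)]

theorem poleRatio_smul {c : ℂ} (hc : c ≠ 0) (w : Coords n) :
    poleRatio (c • w) = poleRatio w := by
  funext b
  rw [poleRatio, poleRatio, poleFun_smul,
    eval_smul_of_isHomogeneous (poleMonomial_isHomogeneous ℂ b),
    mul_div_mul_left _ _ (pow_ne_zero _ hc)]

theorem projDist_le_one (hn : 1 ≤ n) (h0 : polePoly ℂ n ≠ 0) (z : Coords n) :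
    projDist z (algebraicSystem n).polarLocus ≤ 1 := by
  refine div_le_one_of_le₀ (infDist_le_norm ?_ z) (norm_nonneg _)
  intro w hw t ht
  have ht' : (t : ℂ) ≠ 0 := by exact_mod_cast ht.ne'
  rw [mem_polarLocus_iff hn h0] at hw ⊢
  exact ⟨smul_ne_zero ht' hw.1, by rw [poleFun_smul, hw.2, mul_zero]⟩

/-- Needed because `Metric.infDist` to the empty set is 0. The last coordinate point has t_0 = 0
since n ≥ 1. -/
theorem polarLocus_nonempty (hn : 1 ≤ n) (h0 : polePoly ℂ n ≠ 0) :
    (algebraicSystem n).polarLocus.Nonempty := by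
  refine ⟨Pi.single (Fin.last n) 1, (mem_polarLocus_iff hn h0).mpr ⟨?_, ?_⟩⟩
  · simp
  · have : (0 : Fin (n + 1)) ≠ Fin.last n := by
      intro h
      have := congrArg Fin.val h
      simp at this
      omega
    rw [poleFun, Pi.single_eq_of_ne this, zero_mul]

theorem projDist_pos (hn : 1 ≤ n) (h0 : polePoly ℂ n ≠ 0) {z : Coords n} (hz : poleFun z ≠ 0) :
    0 < projDist z (algebraicSystem n).polarLocus := by
  have hz0 : z ≠ 0 := ((mem_regularSet_iff hn h0).mpr hz).1
  refine div_pos ?_ (norm_pos_iff.mpr fun h => hz0 (congrArg WithLp.ofLp h))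
  rw [← Metric.infDist_pos_iff_notMem_closure ((polarLocus_nonempty hn h0).image _)]
  have hc : IsClosed {x : EuclideanSpace ℂ (Fin (n + 1)) | poleFun (WithLp.ofLp x) = 0} := by
    have h1 : Continuous fun w : Coords n => poleFun w :=
      continuous_iff_continuousAt.mpr fun w => (analyticAt_poleFun w).continuousAt
    have h2 : Continuous fun x : EuclideanSpace ℂ (Fin (n + 1)) => WithLp.ofLp x :=
      PiLp.continuous_ofLp 2 _
    exact isClosed_eq (h1.comp h2) continuous_const
  intro h
  refine hz (closure_minimal ?_ hc h)
  rintro _ ⟨w, hw, rfl⟩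
  exact ((mem_polarLocus_iff hn h0).mp hw).2

/-- The roots and the added functions are unchanged by scaling w, so w may be scaled to norm one,
where the growth bound applies. The Łojasiewicz inequality then turns 1/|G| into K r^{-e}; as r ≤ 1,
the summand 1 in `growthScale` is absorbed as well. -/
theorem exists_projDist_bound (hn : 1 ≤ n) (h0 : polePoly ℂ n ≠ 0) :
    ∃ C : ℝ, ∃ N : ℕ, 0 ≤ C ∧ ∀ (w : Coords n) (y : Fin n → ℂ), poleFun w ≠ 0 →
      IsRootSystem w y → ∀ i j,
      ‖fundMatrix w y i j‖ ≤ C * (projDist w (algebraicSystem n).polarLocus)⁻¹ ^ N ∧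
        ‖(fundMatrix w y)⁻¹ i j‖ ≤ C * (projDist w (algebraicSystem n).polarLocus)⁻¹ ^ N := by
  obtain ⟨C, N, hC, hbound⟩ := exists_growth_bound_sysMatrix hn
  obtain ⟨v, hv⟩ : ∃ v, MvPolynomial.eval v (polePoly ℂ n) ≠ 0 := by
    by_contra! h
    exact h0 (MvPolynomial.funext fun v => by rw [h v, map_zero])
  set e := n * (n + 1) + 1 with he
  set K : ℝ := ‖hermitian v‖ ^ e / ‖MvPolynomial.eval v (polePoly ℂ n)‖ with hK
  have hK0 : 0 ≤ K := by positivity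
  refine ⟨C * (1 + K) ^ N, e * N, by positivity, fun w y hw hy => ?_⟩
  have hw0 : w ≠ 0 := ((mem_regularSet_iff hn h0).mpr hw).1
  have hnorm : 0 < ‖hermitian w‖ := norm_pos_iff.mpr fun h => hw0 (congrArg WithLp.ofLp h)
  set c : ℂ := ((‖hermitian w‖⁻¹ : ℝ) : ℂ) with hc
  have hc0 : c ≠ 0 := by
    rw [hc]
    exact_mod_cast (inv_pos.mpr hnorm).ne'
  have hcn : ‖c‖ = ‖hermitian w‖⁻¹ := by
    rw [hc, Complex.norm_real, Real.norm_of_nonneg (inv_nonneg.mpr hnorm.le)]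
  let p : NormalizedPoint n := ⟨(c • w, y), fun i => by
    change ‖c • w i‖ ≤ 1
    rw [norm_smul, hcn, inv_mul_le_iff₀ hnorm, mul_one]
    exact PiLp.norm_apply_le (hermitian w) i, by
    change poleFun (c • w) ≠ 0
    rw [poleFun_smul]
    exact mul_ne_zero (pow_ne_zero _ hc0) hw, hy.smul c⟩
  set r := projDist w (algebraicSystem n).polarLocus with hr
  have hr0 : 0 < r := projDist_pos hn h0 hw
  have hr1 : 1 ≤ r⁻¹ := (one_le_inv₀ hr0).mpr (projDist_le_one hn h0 w)
  have hscale : growthScale p ≤ (1 + K) * r⁻¹ ^ e := by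
    have h1 := infDist_pow_le (polePoly_isHomogeneous ℂ)
      (S := (algebraicSystem n).polarLocus) (fun w => by
        rw [mem_polarLocus_iff hn h0, eval_polePoly]) hv w
    have h2 : Metric.infDist (hermitian w) (hermitian '' (algebraicSystem n).polarLocus) =
        r * ‖hermitian w‖ := (div_mul_cancel₀ _ hnorm.ne').symm
    rw [h2, mul_pow, eval_polePoly w] at h1
    have h3 : ‖poleFun (c • w)‖⁻¹ ≤ K * r⁻¹ ^ e := by
      rw [poleFun_smul, norm_mul, norm_pow, hcn, hK, inv_pow, inv_pow, mul_inv, inv_inv,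
        ← div_eq_mul_inv, ← div_eq_mul_inv, div_div,
        div_le_div_iff₀ (norm_pos_iff.mpr hw) (mul_pos (norm_pos_iff.mpr hv) (pow_pos hr0 _))]
      calc _ = ‖MvPolynomial.eval v (polePoly ℂ n)‖ * (r ^ e * ‖hermitian w‖ ^ e) := by ring
        _ ≤ _ := h1
        _ = _ := by ring
    rw [growthScale, add_mul, one_mul]
    exact add_le_add (one_le_pow₀ hr1) h3
  have hpow : C * growthScale p ^ N ≤ C * (1 + K) ^ N * r⁻¹ ^ (e * N) := by
    rw [mul_assoc, pow_mul, ← mul_pow]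
    have := one_le_growthScale p
    gcongr
  intro i j
  have hM : sysMatrix p.1.2 (poleRatio p.1.1) = sysMatrix y (poleRatio w) := by
    rw [poleRatio_smul hc0]
  obtain ⟨h1, h2⟩ := hbound ((sysEquiv n).symm i) ((sysEquiv n).symm j) p
  rw [hM] at h1 h2
  refine ⟨h1.trans hpow, ?_⟩
  rw [fundMatrix, Matrix.inv_submatrix_equiv]
  exact h2.trans hpow

end Normalization

/-! ### Locally constant properties on cones -/

section Cone

variable {m : ℕ}

/-- The preimage is the union of all nonzero dilates of O. Openness of the projection carries local
constancy from the cone down to U. -/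
theorem isOpen_cone_image {O : Set (Coords m)} (hO : IsOpen O) :
    IsOpen {u : CP m | ∃ (w : Coords m) (hw : w ≠ 0), w ∈ O ∧ Projectivization.mk ℂ w hw = u} := by
  rw [isOpen_coinduced, isOpen_induced_iff]
  refine ⟨⋃ c : ℂˣ, (fun w : Coords m => (c : ℂ) • w) ⁻¹' O,
    isOpen_iUnion fun c => hO.preimage (continuous_const_smul _), ?_⟩
  ext ⟨v, hv⟩
  simp only [Set.mem_preimage, Set.mem_iUnion, Set.mem_ofPred_eq, Projectivization.mk'_eq_mk]
  constructor
  · rintro ⟨c, hc⟩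
    exact ⟨(c : ℂ) • v, smul_ne_zero c.ne_zero hv, hc,
      (Projectivization.mk_eq_mk_iff ℂ _ _ _ _).mpr ⟨c, rfl⟩⟩
  · rintro ⟨w, hw, hwO, h⟩
    obtain ⟨c, hc⟩ := (Projectivization.mk_eq_mk_iff ℂ _ _ _ _).mp h
    refine ⟨c, ?_⟩
    change c • v ∈ O
    rwa [hc]

theorem smul_mem_cone {U : Set (CP m)} {z : Coords m} (hz : z ∈ cone U) {c : ℂ} (hc : c ≠ 0) :
    c • z ∈ cone U := by
  obtain ⟨h0, hU⟩ := hz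
  refine ⟨smul_ne_zero hc h0, ?_⟩
  convert! hU using 1
  exact (Projectivization.mk_eq_mk_iff' ℂ _ _ _ _).mpr ⟨c, rfl⟩

/-- A locally constant property on the cone over a connected set is constant. -/
theorem cone_iff_of_eventually_iff {U : Set (CP m)} [PreconnectedSpace U] {P : Coords m → Prop}
    (h : ∀ z ∈ cone U, ∀ᶠ w in 𝓝[cone U] z, (P w ↔ P z)) {z w : Coords m} (hz : z ∈ cone U)
    (hw : w ∈ cone U) : P z ↔ P w := by
  -- On each punctured complex line the property is constant because ℂ ∖ {0} is connected, so it
  -- descends to a property of points of U.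
  have hscale : ∀ z ∈ cone U, ∀ c : ℂ, c ≠ 0 → (P (c • z) ↔ P z) := by
    intro z hz c hc
    have hpre : PreconnectedSpace ({0}ᶜ : Set ℂ) := by
      rw [← isPreconnected_iff_preconnectedSpace]
      exact (isConnected_compl_singleton_of_one_lt_rank
        (by rw [Complex.rank_real_complex]; norm_num) 0).isPreconnected
    have := iff_of_eventually_iff (α := ({0}ᶜ : Set ℂ)) (P := fun c => P ((c : ℂ) • z))
      (fun c => ?_) ⟨c, hc⟩ ⟨1, one_ne_zero⟩
    · simpa using this
    · have hcont : Tendsto (fun c : ({0}ᶜ : Set ℂ) => (c : ℂ) • z) (𝓝 c)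
          (𝓝[cone U] ((c : ℂ) • z)) := by
        refine tendsto_nhdsWithin_iff.mpr ⟨?_, Eventually.of_forall fun c => smul_mem_cone hz c.2⟩
        have : Continuous fun c : ({0}ᶜ : Set ℂ) => (c : ℂ) • z := by fun_prop
        exact this.tendsto c
      exact hcont.eventually (h _ (smul_mem_cone hz c.2))
  let Q : U → Prop := fun u => P u.1.rep
  have hQ : ∀ (z : Coords m) (h0 : z ≠ 0) (hU : Projectivization.mk ℂ z h0 ∈ U),
      Q ⟨_, hU⟩ ↔ P z := by
    intro z h0 hU
    obtain ⟨a, ha⟩ := Projectivization.exists_smul_eq_mk_rep ℂ z h0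
    change P (Projectivization.mk ℂ z h0).rep ↔ P z
    rw [← ha]
    exact hscale z ⟨h0, hU⟩ a a.ne_zero
  have hconst := iff_of_eventually_iff (P := Q) fun u => ?_
  · obtain ⟨hz0, hzU⟩ := hz
    obtain ⟨hw0, hwU⟩ := hw
    rw [← hQ z hz0 hzU, ← hQ w hw0 hwU]
    exact hconst _ _
  · have hu : u.1.rep ∈ cone U := ⟨u.1.rep_nonzero, by rw [u.1.mk_rep]; exact u.2⟩
    obtain ⟨O, hO, hzO, hOU⟩ := mem_nhdsWithin.mp (h _ hu)
    have hnhds : {u' : CP m | ∃ (w : Coords m) (hw : w ≠ 0), w ∈ O ∧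
        Projectivization.mk ℂ w hw = u'} ∈ 𝓝 u.1 :=
      (isOpen_cone_image hO).mem_nhds ⟨u.1.rep, u.1.rep_nonzero, hzO, u.1.mk_rep⟩
    filter_upwards [continuous_subtype_val.continuousAt.preimage_mem_nhds hnhds] with u' hu'
    obtain ⟨w, hw0, hwO, hwu⟩ := hu'
    have hwU : Projectivization.mk ℂ w hw0 ∈ U := by rw [hwu]; exact u'.2
    have h1 := hQ w hw0 hwU
    have h2 : (⟨_, hwU⟩ : U) = u' := Subtype.ext hwu
    rw [h2] at h1
    rw [h1]
    exact hOU ⟨hwO, hw0, hwU⟩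

end Cone

/-! ### Regularity -/

section Regular

variable {n : ℕ}

theorem norm_matrix_mul_le {d : ℕ} (A B : Matrix (Fin d) (Fin d) ℂ) {K : ℝ}
    (h : ∀ i j, ‖A i j‖ ≤ K) (i j : Fin d) :
    ‖(A * B) i j‖ ≤ K * ∑ k, ∑ l, ‖B k l‖ := by
  rw [Matrix.mul_apply, Finset.mul_sum]
  have hK : 0 ≤ K := (norm_nonneg _).trans (h i j)
  refine norm_sum_le_of_le _ fun k _ => ?_
  rw [norm_mul]
  refine mul_le_mul (h i k) ?_ (norm_nonneg _) hK
  exact Finset.single_le_sum (f := fun l => ‖B k l‖) (fun l _ => norm_nonneg _) (Finset.mem_univ j)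

theorem norm_matrix_mul_le' {d : ℕ} (A B : Matrix (Fin d) (Fin d) ℂ) {K : ℝ}
    (h : ∀ i j, ‖B i j‖ ≤ K) (i j : Fin d) :
    ‖(A * B) i j‖ ≤ K * ∑ k, ∑ l, ‖A l k‖ := by
  have := norm_matrix_mul_le B.transpose A.transpose (K := K) (fun i j => h j i) j i
  rwa [← Matrix.transpose_mul] at this

theorem algebraicSystem_isRegular (hn : 1 ≤ n) (h0 : polePoly ℂ n ≠ 0) :
    (algebraicSystem n).IsRegular := by
  intro U _ hsc hreg F hF
  have hpc : PathConnectedSpace U := inferInstance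
  have hpre : PreconnectedSpace U := inferInstance
  obtain ⟨u⟩ : Nonempty U := inferInstance
  have hz₀ : u.1.rep ∈ cone U := ⟨u.1.rep_nonzero, by rw [u.1.mk_rep]; exact u.2⟩
  have hp : ∀ z ∈ cone U, poleFun z ≠ 0 := fun z hz => (mem_regularSet_iff hn h0).mp (hreg hz)
  obtain ⟨X₀, hX₀, hX₀'⟩ := exists_isSolGerm hn (hp _ hz₀)
  obtain ⟨D, hD, hXD⟩ := (hF.1 _ hz₀).exists_eq_mul hX₀'
  -- One constant matrix D, found at a base point, makes the whole branch a root matrix, because U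
  -- is connected.
  have hsol : ∀ z ∈ cone U, IsSolGerm z fun w => F z w * D := by
    intro z hz
    refine (cone_iff_of_eventually_iff (P := fun z => IsSolGerm z fun w => F z w * D)
      (fun z hz => ?_) hz₀ hz).mp (hX₀.congr hXD.symm)
    filter_upwards [hF.2 z hz, mem_nhdsWithin_of_mem_nhds (eventually_isSolGerm_iff hn (hp z hz)
      (analyticAt_mul_const (hF.1 z hz).1 D))] with w h1 h2
    rw [← h2]
    exact isSolGerm_congr (h1.mono fun v hv => by simp only [hv])
  obtain ⟨C, N, hC, hbound⟩ := exists_projDist_bound hn h0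
  refine ⟨C * (∑ k, ∑ l, ‖D⁻¹ k l‖) + C * ∑ k, ∑ l, ‖D l k‖, N, fun z hz i j => ?_⟩
  obtain ⟨Y, hY, hG⟩ := hsol z hz
  have hFD : F z z * D = fundMatrix z (Y z) := hG.self_of_nhds
  have hDu : IsUnit D.det := hD.isUnit
  have hFz : F z z = fundMatrix z (Y z) * D⁻¹ := by
    rw [← hFD, mul_assoc, Matrix.mul_nonsing_inv _ hDu, mul_one]
  have hFi : (F z z)⁻¹ = D * (fundMatrix z (Y z))⁻¹ := by
    rw [hFz, Matrix.mul_inv_rev, Matrix.nonsing_inv_nonsing_inv _ hDu]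
  have hb := hbound z (Y z) (hp z hz) hY.isRootSystem.self_of_nhds
  rw [hFi, hFz]
  refine (add_le_add (norm_matrix_mul_le _ _ (fun i j => (hb i j).1) i j)
    (norm_matrix_mul_le' _ _ (fun i j => (hb i j).2) i j)).trans_eq ?_
  ring

end Regular

/-! ### Coefficients from roots; the pole polynomial is nonzero -/

section Vieta

variable {R S : Type*} [CommRing R] [CommRing S] {n : ℕ}

/-- The coefficients of the polynomial with leading coefficient `c` and roots `y`. -/
def vietaCoeff (c : R) (y : Fin n → R) (i : Fin (n + 1)) : R :=
  (Polynomial.C c * ∏ j, (Polynomial.X - Polynomial.C (y j))).coeff (n - (i : ℕ))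

theorem map_vietaCoeff (f : R →+* S) (c : R) (y : Fin n → R) (i : Fin (n + 1)) :
    f (vietaCoeff c y i) = vietaCoeff (f c) (f ∘ y) i := by
  rw [vietaCoeff, vietaCoeff, ← Polynomial.coeff_map]
  congr 1
  simp [Polynomial.map_prod]

theorem generalPoly_vietaCoeff (c : R) (y : Fin n → R) (T : R) :
    generalPoly (vietaCoeff c y) T = c * ∏ j, (T - y j) := by
  have hdeg : (Polynomial.C c * ∏ j, (Polynomial.X - Polynomial.C (y j))).natDegree < n + 1 := by
    refine Nat.lt_succ_of_le ((Polynomial.natDegree_C_mul_le _ _).trans ?_)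
    refine (Polynomial.natDegree_prod_le _ _).trans ?_
    refine (Finset.sum_le_card_nsmul _ _ 1 fun j _ => Polynomial.natDegree_X_sub_C_le _).trans ?_
    simp
  have h := Polynomial.eval_eq_sum_range' hdeg T
  rw [Polynomial.eval_mul, Polynomial.eval_C, Polynomial.eval_prod] at h
  simp only [Polynomial.eval_sub, Polynomial.eval_X, Polynomial.eval_C] at h
  rw [h, Finset.sum_range, generalPoly]
  conv_rhs => rw [← Equiv.sum_comp Fin.revPerm]
  refine Finset.sum_congr rfl fun i _ => ?_
  simp only [vietaCoeff, Fin.revPerm_apply, Fin.val_rev, Nat.add_sub_add_right]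

theorem vietaCoeff_zero (c : R) (y : Fin n → R) : vietaCoeff c y 0 = c := by
  have hd : n = ∑ _j : Fin n, 1 := by simp
  have h : (∏ j, (Polynomial.X - Polynomial.C (y j))).coeff (∑ _j : Fin n, 1) = 1 := by
    have := Polynomial.coeff_prod_of_natDegree_le (s := Finset.univ)
      (f := fun j : Fin n => Polynomial.X - Polynomial.C (y j)) 1
      fun j _ => Polynomial.natDegree_X_sub_C_le _
    simpa using this
  rw [← hd] at h
  rw [vietaCoeff, Fin.val_zero, Nat.sub_zero, Polynomial.coeff_C_mul, h, mul_one]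

theorem isRootSystem_vietaCoeff (c : ℂ) (y : Fin n → ℂ) : IsRootSystem (vietaCoeff c y) y := by
  intro T
  rw [generalPoly_vietaCoeff, vietaCoeff_zero]

theorem eq_of_generalPoly_eq {w w' : Coords n} (h : ∀ T, generalPoly w T = generalPoly w' T) :
    w = w' := by
  have h1 : toPolynomial w = toPolynomial w' := Polynomial.funext fun T => by
    rw [eval_toPolynomial, eval_toPolynomial, h]
  funext i
  rw [← coeff_toPolynomial_sub w i, h1, coeff_toPolynomial_sub]

theorem IsRootSystem.eq_vietaCoeff {w : Coords n} {y : Fin n → ℂ} (h : IsRootSystem w y) :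
    w = vietaCoeff (w 0) y :=
  eq_of_generalPoly_eq fun T => by rw [generalPoly_vietaCoeff, h T]

/-- The transposed Vandermonde matrix diagonalizes E, so det E is the product of the t_0^n y_j
P'(y_j). -/
theorem poleFun_vietaCoeff_ne_zero {c : ℂ} (hc : c ≠ 0) {y : Fin n → ℂ}
    (hy : Function.Injective y) (hy0 : ∀ j, y j ≠ 0) : poleFun (vietaCoeff c y) ≠ 0 := by
  set w := vietaCoeff c y with hw
  have hr : IsRootSystem w y := isRootSystem_vietaCoeff c y
  have h0 : w 0 = c := vietaCoeff_zero c y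
  have hE : eulerMatrix w * (Matrix.vandermonde y).transpose =
      (Matrix.vandermonde y).transpose *
        Matrix.diagonal fun j => w 0 ^ n * eulerPoly w (y j) := by
    ext i j
    rw [Matrix.mul_diagonal]
    have := congrFun (eulerMatrix_mulVec (hr.isRoot j)) i
    rw [Pi.smul_apply, smul_eq_mul, mul_comm] at this
    exact this
  have hdet := congrArg Matrix.det hE
  rw [Matrix.det_mul, Matrix.det_mul, Matrix.det_diagonal, mul_comm] at hdet
  have hV : (Matrix.vandermonde y).transpose.det ≠ 0 := by
    rw [Matrix.det_transpose]
    exact Matrix.det_vandermonde_ne_zero_iff.mpr hy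
  rw [poleFun, mul_left_cancel₀ hV hdet, h0]
  refine mul_ne_zero hc (Finset.prod_ne_zero_iff.mpr fun j _ => mul_ne_zero (pow_ne_zero n hc) ?_)
  rw [← mul_derivPoly, hr.derivPoly_eq, h0]
  refine mul_ne_zero (hy0 j) (mul_ne_zero hc (Finset.prod_ne_zero_iff.mpr fun i hi => ?_))
  exact sub_ne_zero.mpr fun h => Finset.ne_of_mem_erase hi (hy h).symm

variable (n) in
theorem exists_poleFun_ne_zero : ∃ a : Coords n, poleFun a ≠ 0 := by
  refine ⟨vietaCoeff 1 fun j : Fin n => ((j : ℕ) : ℂ) + 1,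
    poleFun_vietaCoeff_ne_zero one_ne_zero (fun i j h => ?_) fun j =>
      Nat.cast_add_one_ne_zero (j : ℕ)⟩
  exact Fin.ext (by exact_mod_cast add_right_cancel h)

variable (n) in
theorem polePoly_complex_ne_zero : polePoly ℂ n ≠ 0 := by
  obtain ⟨a, ha⟩ := exists_poleFun_ne_zero n
  intro h
  rw [← eval_polePoly, h, map_zero] at ha
  exact ha rfl

variable (n) in
theorem polePoly_int_ne_zero : polePoly ℤ n ≠ 0 := by
  intro h
  refine polePoly_complex_ne_zero n ?_
  rw [← map_polePoly (Int.castRingHom ℂ), h, map_zero]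

end Vieta

/-! ### Paths between numberings of the roots -/

section Transitivity

variable {n : ℕ}

/-- Any two numberings of the roots outside the polar locus are connected by a path. -/
theorem exists_path_isRootSystem {a z : Coords n} (ha : poleFun a ≠ 0) (hz : poleFun z ≠ 0)
    {y y' : Fin n → ℂ} (hy : IsRootSystem a y) (hy' : IsRootSystem z y') :
    ∃ (γ : Path a z) (η : unitInterval → Fin n → ℂ), Continuous η ∧ η 0 = y ∧ η 1 = y' ∧
      ∀ s, poleFun (γ s) ≠ 0 ∧ IsRootSystem (γ s) (η s) := by
  -- Leading coefficient and roots are interpolated linearly in a complex parameter u. The real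
  -- segment may hit G = 0, but the complex line leaves room to go around.
  let l : ℂ → ℂ → Polynomial ℂ := fun p q => Polynomial.C p + Polynomial.X * Polynomial.C (q - p)
  have hl0 : ∀ p q, (l p q).eval 0 = p := fun p q => by simp [l]
  have hl1 : ∀ p q, (l p q).eval 1 = q := fun p q => by simp [l]
  let c : Polynomial ℂ := l (a 0) (z 0)
  let Y : Fin n → Polynomial ℂ := fun j => l (y j) (y' j)
  let W : Fin (n + 1) → Polynomial ℂ := vietaCoeff c Y
  have hW : ∀ u : ℂ, (fun i => (W i).eval u) =
      vietaCoeff (c.eval u) (fun j => (Y j).eval u) := by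
    intro u
    funext i
    exact map_vietaCoeff (Polynomial.evalRingHom u) c Y i
  have hW0 : (fun i => (W i).eval 0) = a := by
    rw [hW]
    simp only [c, Y, hl0]
    exact hy.eq_vietaCoeff.symm
  have hW1 : (fun i => (W i).eval 1) = z := by
    rw [hW]
    simp only [c, Y, hl1]
    exact hy'.eq_vietaCoeff.symm
  have hg : ∀ u : ℂ, (poleFun W).eval u = poleFun fun i => (W i).eval u := fun u =>
    map_poleFun (Polynomial.evalRingHom u) W
  have hg0 : poleFun W ≠ 0 := by
    intro h
    apply ha
    rw [← hW0, ← hg, h, Polynomial.eval_zero]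
  -- G along the family is a polynomial in u that is nonzero at u = 0, so only finitely many
  -- parameters are bad and their complement in ℂ is path connected.
  have hfin : {u : ℂ | (poleFun W).IsRoot u}.Finite := Polynomial.finite_setOfPred_isRoot hg0
  have hpc := hfin.countable.isPathConnected_compl_of_one_lt_rank
    (E := ℂ) (by rw [Complex.rank_real_complex]; norm_num)
  obtain ⟨σ, hσ⟩ := hpc.joinedIn 0 (by
      intro h
      have h : (poleFun W).eval 0 = 0 := h
      rw [hg, hW0] at h
      exact ha h) 1 (by
      intro h
      have h : (poleFun W).eval 1 = 0 := h
      rw [hg, hW1] at h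
      exact hz h)
  refine ⟨⟨⟨fun s i => (W i).eval (σ s), ?_⟩, ?_, ?_⟩, fun s j => (Y j).eval (σ s), ?_, ?_, ?_,
    fun s => ⟨?_, ?_⟩⟩
  · exact continuous_pi fun i => (W i).continuous.comp σ.continuous
  · simpa using hW0
  · simpa using hW1
  · exact continuous_pi fun j => (Y j).continuous.comp σ.continuous
  · funext j
    simp [Y, hl0]
  · funext j
    simp [Y, hl1]
  · change poleFun (fun i => (W i).eval (σ s)) ≠ 0
    rw [← hg]
    exact hσ s
  · change IsRootSystem (fun i => (W i).eval (σ s)) _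
    rw [hW]
    exact isRootSystem_vietaCoeff _ _

theorem IsRootGerm.eventuallyEq {z : Coords n} {Y Y' : Coords n → Fin n → ℂ}
    (h : ∀ᶠ p : Coords n × (Fin n → ℂ) in 𝓝 (z, Y' z), IsRootSystem p.1 p.2 → p.2 = Y p.1)
    (hY' : IsRootGerm z Y') : Y' =ᶠ[𝓝 z] Y := by
  have hc : Tendsto (fun w => (w, Y' w)) (𝓝 z) (𝓝 (z, Y' z)) :=
    continuousAt_id.prodMk hY'.continuousAt
  filter_upwards [hc.eventually h, hY'.isRootSystem] with w h1 h2 using h1 h2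

/-- The fundamental matrix continues along a path of numberings of the roots. -/
theorem exists_isAnalyticContinuation (hn : 1 ≤ n) {γ : unitInterval → Coords n}
    (hγ : Continuous γ) {η : unitInterval → Fin n → ℂ} (hη : Continuous η)
    (h : ∀ s, poleFun (γ s) ≠ 0 ∧ IsRootSystem (γ s) (η s)) {Y₀ : Coords n → Fin n → ℂ}
    (hY₀ : IsRootGerm (γ 0) Y₀) (hY₀' : Y₀ (γ 0) = η 0) :
    ∃ Y : unitInterval → Coords n → Fin n → ℂ,
      IsAnalyticContinuation γ (fun s w => fundMatrix w (Y s w)) ∧ Y 0 =ᶠ[𝓝 (γ 0)] Y₀ ∧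
      IsRootGerm (γ 1) (Y 1) ∧ Y 1 (γ 1) = η 1 := by
  -- At each time take the germ of root numberings through η s. Continuity of (γ, η) and joint local
  -- uniqueness make nearby germs agree.
  choose Y hY hYη hYu using fun s => exists_isRootGerm hn (h s).1 (h s).2
  refine ⟨Y, ⟨fun s i j => analyticAt_fundMatrix (h s).1 (hY s).analyticAt i j, fun s => ?_⟩, ?_,
    hY 1, hYη 1⟩
  · have hc : Tendsto (fun s => (γ s, η s)) (𝓝 s) (𝓝 (γ s, η s)) :=
      (hγ.prodMk hη).tendsto s
    filter_upwards [hc.eventually (hYu s).eventually_nhds] with s' hs'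
    rw [← hYη s'] at hs'
    exact ((hY s').eventuallyEq hs').mono fun w hw => by simp only [hw]
  · have := hYu 0
    rw [← hY₀'] at this
    exact (hY₀.eventuallyEq this).symm

end Transitivity

/-! ### Assembling the Q-system and the branches -/

section Main

variable {n : ℕ}

theorem algebraicSystem_isQSystem (hn : 1 ≤ n) : (algebraicSystem n).IsQSystem where
  flat := algebraicSystem_isFlat hn (polePoly_complex_ne_zero n)
  regular := algebraicSystem_isRegular hn (polePoly_complex_ne_zero n)
  quasiunipotent := algebraicSystem_isQuasiunipotent hn (polePoly_complex_ne_zero n)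
  definedOverRat := algebraicSystem_isDefinedOverRat (polePoly_int_ne_zero n)

theorem sum_single_mul {d : ℕ} (i₀ j₀ : Fin d) (M : Matrix (Fin d) (Fin d) ℂ) :
    ∑ i, ∑ j, Matrix.single i₀ j₀ (1 : ℂ) i j * M i j = M i₀ j₀ := by
  rw [Finset.sum_eq_single i₀, Finset.sum_eq_single j₀]
  · simp
  · intro j _ hj
    simp [hj.symm]
  · simp
  · intro i _ hi
    refine Finset.sum_eq_zero fun j _ => ?_
    simp [hi.symm]
  · simp

/-- Germs of a branch with the same value at a point outside the polar locus coincide. -/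
theorem eventuallyEq_of_generalPoly_eq_zero (hn : 1 ≤ n) {z : Coords n} (hz : poleFun z ≠ 0)
    {f g : Coords n → ℂ} (hf : ContinuousAt f z) (hg : ContinuousAt g z) (hfg : f z = g z)
    (hf' : ∀ᶠ w in 𝓝 z, generalPoly w (f w) = 0) (hg' : ∀ᶠ w in 𝓝 z, generalPoly w (g w) = 0) :
    f =ᶠ[𝓝 z] g := by
  have hroot := hf'.self_of_nhds
  obtain ⟨φ, -, -, hu⟩ := exists_analyticAt_root hroot (derivPoly_ne_zero hn hz hroot)
  have h : ∀ q : Coords n → ℂ, ContinuousAt q z → f z = q z →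
      (∀ᶠ w in 𝓝 z, generalPoly w (q w) = 0) → q =ᶠ[𝓝 z] φ := by
    intro q hq hqz hq'
    have hc : Tendsto (fun w => (w, q w)) (𝓝 z) (𝓝 (z, f z)) := by
      rw [hqz]
      exact continuousAt_id.prodMk hq
    filter_upwards [hc.eventually hu, hq'] with w h1 h2 using h1.mp h2
  exact (h f hf rfl hf').trans (h g hg hfg hg').symm

end Main

end QFun

end

open QFun in
/-- The general algebraic function of degree `n ≥ 1` is a Q-function of its arguments
`t_0, …, t_n`, considered as homogeneous coordinates on `ℂP^n`. -/
theorem mainTheorem5 (n : ℕ) (hn : 1 ≤ n) :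
    QFun.IsQFunction (QFun.generalAlgebraicFunction n) := by
  have h0 := polePoly_complex_ne_zero n
  obtain ⟨a, ha⟩ := exists_poleFun_ne_zero n
  obtain ⟨ya, hya⟩ := exists_isRootSystem (left_ne_zero_of_mul ha : a 0 ≠ 0)
  obtain ⟨Ya, hYa, hYa', -⟩ := exists_isRootGerm hn ha hya
  refine ⟨sysDim n, algebraicSystem n, algebraicSystem_isQSystem hn, a,
    (mem_regularSet_iff hn h0).mpr ha, fun w => fundMatrix w (Ya w),
    hYa.isFundamentalSolutionAt hn ha,
    Matrix.single (sysEquiv n (Sum.inl ⟨0, hn⟩)) (sysEquiv n (Sum.inl ⟨0, hn⟩)) 1,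
    fun z hz f => ?_⟩
  have hpz := (mem_regularSet_iff hn h0).mp hz
  have hentry : ∀ (w : Coords n) (y : Fin n → ℂ), fundMatrix w y
      (sysEquiv n (Sum.inl ⟨0, hn⟩)) (sysEquiv n (Sum.inl ⟨0, hn⟩)) = y ⟨0, hn⟩ := fun w y =>
    congrFun (rootRow_fundMatrix hn w y) ⟨0, hn⟩
  simp only [sum_single_mul]
  constructor
  · rintro ⟨hfa, hf⟩
    have hf : ∀ᶠ w in 𝓝 z, generalPoly w (f w) = 0 := hf
    -- A branch at z takes a root as its value; the roots are numbered with this one first, and the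
    -- path carries the chosen numbering at a to it.
    obtain ⟨y, hy, hy0⟩ := exists_isRootSystem_apply_zero hn hpz hf.self_of_nhds
    obtain ⟨γ, η, hη, hη0, hη1, hγ⟩ := exists_path_isRootSystem ha hpz hya hy
    obtain ⟨Y, hF, hY0, hY1, hY1'⟩ := exists_isAnalyticContinuation hn γ.continuous hη hγ
      (Y₀ := Ya) (by rwa [γ.source]) (by rw [γ.source, hYa', hη0])
    rw [γ.source] at hY0
    rw [γ.target] at hY1 hY1'
    refine ⟨γ, _, fun s => (mem_regularSet_iff hn h0).mpr (hγ s).1, hF,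
      hY0.mono fun w hw => by simp only [hw], ?_⟩
    simp only [hentry]
    refine eventuallyEq_of_generalPoly_eq_zero hn hpz hfa.continuousAt
      (hY1.analyticAt ⟨0, hn⟩).continuousAt ?_ hf
      (hY1.isRootSystem.mono fun w hw => hw.isRoot ⟨0, hn⟩)
    rw [hY1', hη1, hy0]
  · rintro ⟨γ, F, hγ, hF, hF0, hf⟩
    -- Conversely, X is already a root matrix, so D = 1 and every continuation of its selected entry
    -- is a root of P.
    have hs0 : IsSolGerm (γ 0) fun w => F 0 w * 1 := by
      rw [γ.source]
      refine ⟨Ya, hYa, hF0.mono fun w hw => ?_⟩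
      simp only [mul_one, hw]
    obtain ⟨Y, hY, hFY⟩ := isSolGerm_of_isAnalyticContinuation hn γ.continuous
      (fun s => (mem_regularSet_iff hn h0).mp (hγ s)) hF hs0 1
    rw [γ.target] at hY hFY
    have hfY : f =ᶠ[𝓝 z] fun w => Y w ⟨0, hn⟩ := by
      filter_upwards [hf, hFY] with w h1 h2
      rw [mul_one] at h2
      rw [h1, h2, hentry]
    refine ⟨(hY.analyticAt ⟨0, hn⟩).congr hfY.symm, ?_⟩
    filter_upwards [hfY, hY.isRootSystem] with w h1 h2
    rw [h1]
    exact h2.isRoot ⟨0, hn⟩
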